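/- Let $\mathbb K$ be an algebraically closed field and $\Lambda$ a finite dimensional $\mathbb K$-algebra, and let $\mathrm{proj}\Lambda$ be the category of finitely generated projective right $\Lambda$-modules. For $n\ge 2$ let $C_n(\mathrm{proj}\Lambda)$ be the category of (cochain) complexes $X$ over $\mathrm{proj}\Lambda$ with $X^j=0$ for $j\notin\{1,\dots,n\}$. Each indecomposable (in particular nonzero) object $X$ of the bounded homotopy category $K^b(\mathrm{proj}\Lambda)$ is represented by a bounded complex $\bar X$, unique up to isomorphism of complexes, that has no direct summand of the form $\cdots\to 0\to P\xrightarrow{1}P\to 0\to\cdots$ with $P$ indecomposable projective. If $\bar X^r\ne 0\ne \bar X^s$ and $\bar X^i=0$ for $i<r$ and for $i>s$, the length of $X$ is $\ell(X)=s-r$. The strong global dimension $\mathrm{s.gl.dim}(\Lambda)$ is the supremum of $\ell(X)$ over the indecomposable objects $X$ of $K^b(\mathrm{proj}\Lambda)$. Assume that $\mathrm{s.gl.dim}(\Lambda)=\eta$ is finite (equivalently, by a theorem of Happel and Zacharia, that $\Lambda$ is piecewise hereditary) and that $\eta\ge 1$. A morphism $f$ is *irreducible* if it is neither a section nor a retraction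 and, whenever $f=hg$, $g$ is a section or $h$ is a retraction. A sequence $X\xrightarrow{f}B\xrightarrow{g}Y$ in $C_n(\mathrm{proj}\Lambda)$ is *almost split* if $gf=0$, if $0\to X^j\to B^j\to Y^j\to 0$ is split exact for every $j\in\{1,\dots,n\}$, if $f$ is minimal left almost split, and if $g$ is minimal right almost split in $C_n(\mathrm{proj}\Lambda)$. The left and right inclusions ${}_LI,I_R:C_n(\mathrm{proj}\Lambda)\to C_{n+1}(\mathrm{proj}\Lambda)$ send $X^1\to\cdots\to X^n$ to $0\to X^1\to\cdots\to X^n$ and to $X^1\to\cdots\to X^n\to 0$, respectively. The left and right abrupt truncations ${}_*[-],[-]_*:C_{n+1}(\mathrm{proj}\Lambda)\to C_n(\mathrm{proj}\Lambda)$ send $X^1\to\cdots\to X^{n+1}$ to $X^2\to\cdots\to X^{n+1}$ and to $X^1\to\cdots\to X^n$, respectively. **Theorem 2.16.** The following hold. (i) Let $X,Y$ be indecomposable in $C_{\eta+1}(\mathrm{proj}\Lambda)$. A morphism $f:X\to Y$ is irreducible in $C_{\eta+1}(\mathrm{proj}\Lambda)$ if and only if ${}_LI(f)$ or $I_R(f)$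 is irreducible in $C_{\eta+2}(\mathrm{proj}\Lambda)$. Moreover, if $X,Y$ are indecomposable in $C_{\eta+2}(\mathrm{proj}\Lambda)$ and $f:X\to Y$ is irreducible in $C_{\eta+2}(\mathrm{proj}\Lambda)$, then either $X^1=0=Y^1$ and ${}_*[f]$ is irreducible in $C_{\eta+1}(\mathrm{proj}\Lambda)$, or $X^{\eta+2}=0=Y^{\eta+2}$ and $[f]_*$ is irreducible in $C_{\eta+1}(\mathrm{proj}\Lambda)$. (ii) Let $X,Y$ be indecomposable in $C_{\eta+1}(\mathrm{proj}\Lambda)$. A sequence $\delta:X\to B\to Y$ is almost split in $C_{\eta+1}(\mathrm{proj}\Lambda)$ if and only if ${}_LI(\delta)$ or $I_R(\delta)$ is almost split in $C_{\eta+2}(\mathrm{proj}\Lambda)$. Moreover, if $X,Y$ are indecomposable in $C_{\eta+2}(\mathrm{proj}\Lambda)$ and $\delta:X\to B\to Y$ is almost split in $C_{\eta+2}(\mathrm{proj}\Lambda)$, then either $X^1=B^1=Y^1=0$ and ${}_*[\delta]$ is almost split in $C_{\eta+1}(\mathrm{proj}\Lambda)$, or $X^{\eta+2}=B^{\eta+2}=Y^{\eta+2}=0$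 and $[\delta]_*$ is almost split in $C_{\eta+1}(\mathrm{proj}\Lambda)$. (In both "or" statements both alternatives may hold.) -/

import Mathlib

open CategoryTheory CategoryTheory.Limits

universe v u

namespace FixedSizeComplexes

/-! ### Morphisms in a category: irreducible and almost split ones -/

section Morphisms

variable {C : Type u} [Category.{v} C] {X Y Z : C}

/-- `f` is irreducible: it is neither a section nor a retraction, and whenever `f` is
`g` followed by `h`, then `g` is a section or `h` is a retraction. -/
def IsIrreducible (f : X ⟶ Y) : Prop :=
  ¬ IsSplitMono f ∧ ¬ IsSplitEpi f ∧
    ∀ (W : C) (g : X ⟶ W) (h : W ⟶ Y), g ≫ h = f → IsSplitMono g ∨ IsSplitEpi h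

/-- `f` is left almost split and left minimal. -/
def IsMinimalLeftAlmostSplit (f : X ⟶ Y) : Prop :=
  ¬ IsSplitMono f ∧
    (∀ (W : C) (u : X ⟶ W), ¬ IsSplitMono u → ∃ s : Y ⟶ W, f ≫ s = u) ∧
    ∀ u : Y ⟶ Y, f ≫ u = f → IsIso u

/-- `f` is right almost split and right minimal. -/
def IsMinimalRightAlmostSplit (f : X ⟶ Y) : Prop :=
  ¬ IsSplitEpi f ∧
    (∀ (W : C) (u : W ⟶ Y), ¬ IsSplitEpi u → ∃ s : W ⟶ X, s ≫ f = u) ∧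
    ∀ u : X ⟶ X, u ≫ f = f → IsIso u

end Morphisms

/-- A full subcategory of a preadditive category has binary biproducts as soon as any two of its
objects have a biproduct that lies in it. -/
lemma hasBinaryBiproducts_fullSubcategory {C : Type u} [Category.{v} C] [Preadditive C]
    (P : ObjectProperty C)
    (h : ∀ X Y : C, P X → P Y → ∃ b : BinaryBicone X Y,
      P b.pt ∧ b.fst ≫ b.inl + b.snd ≫ b.inr = 𝟙 b.pt) :
    HasBinaryBiproducts P.FullSubcategory where
  has_binary_biproduct X Y := by
    obtain ⟨b, hb, tot⟩ := h X.obj Y.obj X.property Y.property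
    let b' : BinaryBicone X Y :=
      { pt := ⟨b.pt, hb⟩
        fst := ObjectProperty.homMk b.fst
        snd := ObjectProperty.homMk b.snd
        inl := ObjectProperty.homMk b.inl
        inr := ObjectProperty.homMk b.inr
        inl_fst := ObjectProperty.hom_ext _ b.inl_fst
        inl_snd := ObjectProperty.hom_ext _ b.inl_snd
        inr_fst := ObjectProperty.hom_ext _ b.inr_fst
        inr_snd := ObjectProperty.hom_ext _ b.inr_snd }
    exact hasBinaryBiproduct_of_total b' (ObjectProperty.hom_ext _ tot)

/-! ### Finitely generated projective right modules -/

section Algebra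

variable (Λ : Type u) [Ring Λ]

/-- Finitely generated projective right `Λ`-modules (a right module is a module over the
opposite ring). -/
def isProj : ObjectProperty (ModuleCat.{u} Λᵐᵒᵖ) :=
  fun M => Module.Finite Λᵐᵒᵖ M ∧ Module.Projective Λᵐᵒᵖ M

/-- The category of finitely generated projective right `Λ`-modules. -/
abbrev Proj : Type (u + 1) := (isProj Λ).FullSubcategory

instance : (isProj Λ).ContainsZero where
  exists_zero := ⟨ModuleCat.of Λᵐᵒᵖ PUnit.{u + 1},
    ModuleCat.isZero_of_subsingleton _, inferInstanceAs (Module.Finite Λᵐᵒᵖ PUnit.{u + 1}),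
    inferInstanceAs (Module.Projective Λᵐᵒᵖ PUnit.{u + 1})⟩

instance : HasBinaryBiproducts (Proj Λ) :=
  hasBinaryBiproducts_fullSubcategory _ fun M N hM hN => by
    have := hM.1
    have := hM.2
    have := hN.1
    have := hN.2
    let e := ModuleCat.biprodIsoProd M N
    refine ⟨BinaryBiproduct.bicone M N, ⟨?_, ?_⟩, ?_⟩
    · exact Module.Finite.equiv e.toLinearEquiv.symm
    · exact Module.Projective.of_equiv e.toLinearEquiv.symm
    · exact biprod.total

/-! ### Complexes of fixed size -/

/-- Complexes of finitely generated projective right `Λ`-modules, with cohomological grading. -/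
abbrev Cpx : Type (u + 1) := CochainComplex (Proj Λ) ℤ

/-- The complexes `X` with `X^j = 0` for `j` outside `{1, …, n}`. -/
def isSize (n : ℕ) : ObjectProperty (Cpx Λ) :=
  fun X => ∀ j : ℤ, j ∉ Set.Icc (1 : ℤ) n → IsZero (X.X j)

/-- The category `C_n(proj Λ)` of complexes of fixed size `n`. -/
abbrev CSize (n : ℕ) : Type (u + 1) := (isSize Λ n).FullSubcategory

variable {Λ} in
lemma isZero_biprod_X {X Y : Cpx Λ} {j : ℤ} (hX : IsZero (X.X j)) (hY : IsZero (Y.X j)) :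
    IsZero ((X ⊞ Y).X j) :=
  IsZero.of_iso ((biprod_isZero_iff _ _).2 ⟨hX, hY⟩) (HomologicalComplex.biprodXIso X Y j)

instance (n : ℕ) : HasBinaryBiproducts (CSize Λ n) :=
  hasBinaryBiproducts_fullSubcategory _ fun X Y hX hY =>
    ⟨BinaryBiproduct.bicone X Y, fun j hj => isZero_biprod_X (hX j hj) (hY j hj), biprod.total⟩

variable {Λ}

/-- A conflation `X → Y → Z` of `C_n(proj Λ)`: the sequence
`0 → X^j → Y^j → Z^j → 0` is split exact for every `j ∈ {1, …, n}`. -/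
def IsConflation {n : ℕ} {X Y Z : CSize Λ n} (f : X ⟶ Y) (g : Y ⟶ Z) : Prop :=
  ∃ w : f ≫ g = 0, ∀ j ∈ Set.Icc (1 : ℤ) n,
    Nonempty ((ShortComplex.mk f g w).map
      ((isSize Λ n).ι ⋙ HomologicalComplex.eval (Proj Λ) (ComplexShape.up ℤ) j)).Splitting

/-- An almost split sequence of `C_n(proj Λ)`: a conflation `X → Y → Z` whose first morphism is
minimal left almost split and whose second morphism is minimal right almost split. -/
def IsAlmostSplit {n : ℕ} {X Y Z : CSize Λ n} (f : X ⟶ Y) (g : Y ⟶ Z) : Prop :=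
  IsConflation f g ∧ IsMinimalLeftAlmostSplit f ∧ IsMinimalRightAlmostSplit g

/-! ### Abrupt truncations and inclusions -/

variable (Λ)

/-- Renumbering of the cells (without any change of sign of the differentials):
the `i`-th cell of the new complex is the `(i + k)`-th cell of the old one. -/
def reindex (k : ℤ) : Cpx Λ ⥤ Cpx Λ where
  obj X :=
    { X := fun i => X.X (i + k)
      d := fun i j => X.d (i + k) (j + k)
      shape := fun i j hij => X.shape _ _ fun h => hij (by
        simp only [ComplexShape.up_Rel] at h ⊢
        omega)
      d_comp_d' := fun _ _ _ _ _ => X.d_comp_d _ _ _ }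
  map f := { f := fun i => f.f (i + k) }

/-- The left inclusion `C_n(proj Λ) ⥤ C_{n+1}(proj Λ)`, which sends `X^1 → ⋯ → X^n` to
`0 → X^1 → ⋯ → X^n`. -/
def leftIncl (n : ℕ) : CSize Λ n ⥤ CSize Λ (n + 1) :=
  (isSize Λ (n + 1)).lift ((isSize Λ n).ι ⋙ reindex Λ (-1)) fun X j hj =>
    X.property (j + -1) fun h => hj (by
      simp only [Set.mem_Icc] at h ⊢
      push_cast
      omega)

/-- The right inclusion `C_n(proj Λ) ⥤ C_{n+1}(proj Λ)`, which sends `X^1 → ⋯ → X^n` to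
`X^1 → ⋯ → X^n → 0`. -/
def rightIncl (n : ℕ) : CSize Λ n ⥤ CSize Λ (n + 1) :=
  ObjectProperty.ιOfLE fun X hX j hj => hX j fun h => hj (by
    simp only [Set.mem_Icc] at h ⊢
    push_cast
    omega)

/-- The left abrupt truncation `C_{n+1}(proj Λ) ⥤ C_n(proj Λ)`, which sends
`X^1 → X^2 → ⋯ → X^{n+1}` to `X^2 → ⋯ → X^{n+1}`. -/
noncomputable def leftTrunc (n : ℕ) : CSize Λ (n + 1) ⥤ CSize Λ n :=
  (isSize Λ n).lift
    ((isSize Λ (n + 1)).ι ⋙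
      (ComplexShape.embeddingUpIntGE 2).stupidTruncFunctor (Proj Λ) ⋙ reindex Λ 1)
    fun X j hj => by
      by_cases h : j + 1 < 2
      · exact X.obj.isZero_stupidTrunc_X (ComplexShape.embeddingUpIntGE 2) (j + 1)
          ((ComplexShape.notMem_range_embeddingUpIntGE_iff 2 (j + 1)).2 h)
      · refine IsZero.of_iso (X.property (j + 1) fun h' => hj ?_)
          (X.obj.stupidTruncXIso (ComplexShape.embeddingUpIntGE 2) (i := (j - 1).toNat)
            (i' := j + 1) (by simp; omega))
        simp only [Set.mem_Icc] at h' ⊢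
        push_cast at h'
        omega

/-- The right abrupt truncation `C_{n+1}(proj Λ) ⥤ C_n(proj Λ)`, which sends
`X^1 → ⋯ → X^n → X^{n+1}` to `X^1 → ⋯ → X^n`. -/
noncomputable def rightTrunc (n : ℕ) : CSize Λ (n + 1) ⥤ CSize Λ n :=
  (isSize Λ n).lift
    ((isSize Λ (n + 1)).ι ⋙ (ComplexShape.embeddingUpIntLE n).stupidTruncFunctor (Proj Λ))
    fun X j hj => by
      by_cases h : (n : ℤ) < j
      · exact X.obj.isZero_stupidTrunc_X (ComplexShape.embeddingUpIntLE n) j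
          ((ComplexShape.notMem_range_embeddingUpIntLE_iff n j).2 h)
      · refine IsZero.of_iso (X.property j fun h' => hj ?_)
          (X.obj.stupidTruncXIso (ComplexShape.embeddingUpIntLE n) (i := (n - j).toNat)
            (i' := j) (by simp; omega))
        simp only [Set.mem_Icc] at h' ⊢
        omega

/-! ### The bounded homotopy category and the strong global dimension -/

/-- Bounded complexes. -/
def isBounded : ObjectProperty (Cpx Λ) :=
  fun X => ∃ a b : ℤ, ∀ j : ℤ, j ∉ Set.Icc a b → IsZero (X.X j)

/-- The bounded homotopy category `K^b(proj Λ)`: complexes up to homotopy, where the complex is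
bounded. -/
abbrev Kb : Type (u + 1) :=
  ((isBounded Λ).strictMap
    (HomotopyCategory.quotient (Proj Λ) (ComplexShape.up ℤ))).FullSubcategory

instance : HasBinaryBiproducts (Kb Λ) :=
  hasBinaryBiproducts_fullSubcategory _ fun X Y hX hY => by
    obtain ⟨X', ⟨a, b, hab⟩⟩ := hX
    obtain ⟨Y', ⟨c, d, hcd⟩⟩ := hY
    let F := HomotopyCategory.quotient (Proj Λ) (ComplexShape.up ℤ)
    refine ⟨F.mapBinaryBicone (BinaryBiproduct.bicone X' Y'),
      ⟨X' ⊞ Y', min a c, max b d, fun j hj => ?_⟩, ?_⟩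
    · refine isZero_biprod_X (hab j fun h => hj ?_) (hcd j fun h => hj ?_)
      all_goals
        simp only [Set.mem_Icc] at h ⊢
        omega
    · have h : F.map (biprod.fst : X' ⊞ Y' ⟶ X') ≫ F.map biprod.inl +
          F.map (biprod.snd : X' ⊞ Y' ⟶ Y') ≫ F.map biprod.inr = 𝟙 (F.obj (X' ⊞ Y')) := by
        rw [← F.map_comp, ← F.map_comp, ← F.map_add, biprod.total, F.map_id]
      exact h

variable {Λ}

/-- The contractible complex `⋯ → 0 → P → P → 0 → ⋯` with the identity of `P` between the
cells `k` and `k + 1`. -/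
noncomputable def contractible (P : Proj Λ) (k : ℤ) : Cpx Λ :=
  HomologicalComplex.double (c := ComplexShape.up ℤ) (𝟙 P) (i₀ := k) (i₁ := k + 1) rfl

/-- `X'` is a representative of `X` without a direct summand of the form `P → P`
with `P` an indecomposable projective. -/
def IsMinimalRepresentative (X : Kb Λ) (X' : Cpx Λ) : Prop :=
  Nonempty ((HomotopyCategory.quotient (Proj Λ) (ComplexShape.up ℤ)).obj X' ≅ X.obj) ∧
    ∀ (P : Proj Λ) (k : ℤ), Indecomposable P → IsEmpty (Retract (contractible P k) X')

/-- The object `X` of `K^b(proj Λ)` has length `l`: its minimal representative is nonzero in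
some degrees `r` and `r + l`, and zero outside the interval `[r, r + l]`. -/
def HasLength (X : Kb Λ) (l : ℕ) : Prop :=
  ∃ X' : Cpx Λ, IsMinimalRepresentative X X' ∧ ∃ r : ℤ,
    ¬ IsZero (X'.X r) ∧ ¬ IsZero (X'.X (r + l)) ∧
      ∀ j : ℤ, j ∉ Set.Icc r (r + l) → IsZero (X'.X j)

variable (Λ)

/-- The strong global dimension of `Λ`: the supremum of the lengths of the indecomposable
objects of `K^b(proj Λ)`. -/
noncomputable def strongGlobalDimension : ℕ∞ :=
  sSup {e : ℕ∞ | ∃ (X : Kb Λ) (l : ℕ), Indecomposable X ∧ HasLength X l ∧ e = l}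

end Algebra

end FixedSizeComplexes

open FixedSizeComplexes

/-!
Write `C_n` for `C_n(proj Λ)`, and say that a complex is supported in `[a, b]` if its cells outside
this interval vanish. The proof rests on two consequences of `s.gl.dim Λ = η`.

*Splitting* (`exists_splitting`). An indecomposable complex with nonzero cells in the degrees `a`
and `b`, where `b - a ≥ 2`, is its own minimal representative, is not contractible, and stays
indecomposable in the homotopy category, because its endomorphisms are invertible or nilpotent. So
its width `b - a` is at most `η`. Hence a complex supported in an interval `[a, b]` with `b - a > η`
is a direct sum of a complex supported in `[a, b - 1]` and one supported in `[a + 1, b]`.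

*Factorization* (`exists_factorization`). Let `φ : U ⟶ F`, with `U` supported in `[a, b]` and `F` in
`[a + 1, b + 1]`, where `b - a + 1 ≥ η`. Then `φ` factors through a complex supported in
`[a + 1, b]`. For the mapping cone of `φ` is supported in `[a - 1, b + 1]`, so that it is a direct
sum of some `C₁` supported in `[a - 1, b]` and `C₂` supported in `[a, b + 1]`. The composite
`U ⟶ F ⟶ C₂` is nullhomotopic, so `φ` factors through the mapping cocone of `ψ : F ⟶ C₂`. In the
degrees above `b` neither `C₁` nor the shift of `U` contributes to the cone, so `ψ` is invertible
there and the cocone is contractible there. This contractible part can be split off (`exists_trim`),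
which leaves a complex supported in `[a + 1, b]`.

*From `C_{η+1}` to `C_{η+2}`.* Both inclusions are fully faithful, so they reflect irreducible
morphisms and almost split sequences. They preserve those which end at `Y` as soon as each morphism
`W ⟶ F Y` factors through an object `F V`, by a morphism `F V ⟶ F Y` which is a retraction only if
the given morphism is one (`FactorsThroughImage`). If `Y` is indecomposable, one of the inclusions
has this property: the right one if the last cell of `Y` vanishes, by truncating `W`, and the left
one otherwise, by the splitting of `W` and the factorization theorem
(`factorsThroughImage_incl`). This handles irreducible and right almost split morphisms. The
left almost split property of the first morphism of a conflation follows from the right almost split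
property of the second one by a pushout argument, since the first term has only invertible and
nilpotent endomorphisms (`IsDegSplit.exists_extension`).

*From `C_{η+2}` to `C_{η+1}`.* The indecomposable objects `X` and `Y` vanish at one end each. If
they did not vanish at a common end, then `f` would factor through a truncation of `Y`, or, by the
factorization theorem, through a complex in `C_{η+2}` which vanishes at both ends, and neither
factor could be split (`isZero_or_isZero_of_isIrreducible`). For an almost split sequence, the same
factorizations are applied to the composite of `f : X ⟶ B` with the projection to a summand of `B`
(`isZero_or_isZero_of_isAlmostSplit`). An object which vanishes at an end is the inclusion of its
truncation (`isIso_leftComparison`, `isIso_rightComparison`), so that the reflection of irreducible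
morphisms and almost split sequences applies.
-/

namespace FixedSizeComplexes

/-! ### Group inverses of endomorphisms of modules -/

/-- An object is Fitting if each of its endomorphisms is an isomorphism or nilpotent. -/
def IsFitting {C : Type*} [Category* C] [HasZeroMorphisms C] (X : C) : Prop :=
  ∀ φ : X ⟶ X, IsIso φ ∨ ∃ n : ℕ, (End.of φ ^ n).asHom = 0

/-- If `M = ker a ⊕ range a`, then `a` has a group inverse `g`; the idempotent `a * g` is the
projection onto the range of `a`. -/
lemma exists_groupInverse_of_isCompl {R M : Type*} [Ring R] [AddCommGroup M] [Module R M]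
    (a : Module.End R M) (h : IsCompl (LinearMap.ker a) (LinearMap.range a)) :
    ∃ g : Module.End R M, a * g = g * a ∧ a * (a * g) = a := by
  have hmem : ∀ x ∈ LinearMap.range a, a x ∈ LinearMap.range a := fun x _ => ⟨x, rfl⟩
  let ar : LinearMap.range a →ₗ[R] LinearMap.range a := a.restrict hmem
  have hinj : Function.Injective ar := by
    rw [← LinearMap.ker_eq_bot, LinearMap.ker_eq_bot']
    rintro ⟨x, hx⟩ hx0
    have h0 : a x = 0 := congrArg Subtype.val hx0
    have := h.disjoint.le_bot ⟨(LinearMap.mem_ker.2 h0 : x ∈ LinearMap.ker a), hx⟩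
    exact Subtype.ext this
  have hsurj : Function.Surjective ar := by
    rintro ⟨_, x, rfl⟩
    obtain ⟨k, hk, _, ⟨y, rfl⟩, rfl⟩ :=
      Submodule.mem_sup.1 (h.codisjoint.eq_top ▸ Submodule.mem_top : x ∈ _ ⊔ _)
    refine ⟨⟨a y, y, rfl⟩, Subtype.ext ?_⟩
    change a (a y) = a (k + a y)
    rw [map_add, LinearMap.mem_ker.1 hk, zero_add]
  let e := LinearEquiv.ofBijective ar ⟨hinj, hsurj⟩
  let π := (LinearMap.range a).projectionOnto (LinearMap.ker a) h.symm
  have hπ : ∀ x, π (a x) = ⟨a x, x, rfl⟩ := fun x =>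
    Submodule.projectionOnto_apply_left h.symm ⟨a x, x, rfl⟩
  have hπk : ∀ k ∈ LinearMap.ker a, π k = 0 := fun k hk =>
    Submodule.projectionOnto_apply_right h.symm ⟨k, hk⟩
  let g : Module.End R M := (LinearMap.range a).subtype ∘ₗ e.symm.toLinearMap ∘ₗ π
  have hag : ∀ x, a (g x) = (π x : M) := fun x => by
    change ((e (e.symm (π x)) : LinearMap.range a) : M) = _
    rw [e.apply_symm_apply]
  have hgaa : ∀ y, g (a (a y)) = a y := fun y => by
    change ((e.symm (π (a (a y))) : LinearMap.range a) : M) = _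
    rw [hπ]
    have : (⟨a (a y), a y, rfl⟩ : LinearMap.range a) = e ⟨a y, y, rfl⟩ := rfl
    rw [this, e.symm_apply_apply]
  have key : ∀ x, a (g x) = g (a x) := fun x => by
    obtain ⟨k, hk, _, ⟨y, rfl⟩, rfl⟩ :=
      Submodule.mem_sup.1 (h.codisjoint.eq_top ▸ Submodule.mem_top : x ∈ _ ⊔ _)
    rw [hag, map_add, map_add, hπk k hk, LinearMap.mem_ker.1 hk, zero_add, zero_add, hgaa, hπ]
  refine ⟨g, LinearMap.ext key, LinearMap.ext fun x => ?_⟩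
  change a (a (g x)) = a x
  rw [key, hag, hπ]

section Algebra

variable {Λ : Type u} [Ring Λ]

/-- The linear map underlying a morphism of projective modules. -/
abbrev Proj.lin {M N : Proj Λ} (f : M ⟶ N) : M.obj →ₗ[Λᵐᵒᵖ] N.obj := f.hom.hom

/-- The morphism of projective modules given by a linear map. -/
abbrev Proj.ofLin {M N : Proj Λ} (f : M.obj →ₗ[Λᵐᵒᵖ] N.obj) : M ⟶ N :=
  ObjectProperty.homMk (ModuleCat.ofHom f)

lemma Proj.lin_injective {M N : Proj Λ} {f g : M ⟶ N} (h : Proj.lin f = Proj.lin g) : f = g :=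
  ObjectProperty.hom_ext _ (ModuleCat.hom_ext h)

instance : IsIdempotentComplete (Proj Λ) where
  idempotents_split M p hp := by
    obtain ⟨Y, i, e, hie, hei⟩ := IsIdempotentComplete.idempotents_split M.obj p.hom
      (congrArg (fun x => x.hom) hp)
    have h : e.hom ∘ₗ i.hom = LinearMap.id := congrArg ModuleCat.Hom.hom hie
    have := M.property.1
    have := M.property.2
    have h1 : Module.Finite Λᵐᵒᵖ Y :=
      Module.Finite.of_surjective e.hom fun y => ⟨i.hom y, LinearMap.congr_fun h y⟩
    have h2 : Module.Projective Λᵐᵒᵖ Y := Module.Projective.of_split i.hom e.hom h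
    exact ⟨⟨Y, h1, h2⟩, ObjectProperty.homMk i, ObjectProperty.homMk e,
      ObjectProperty.hom_ext _ hie, ObjectProperty.hom_ext _ hei⟩

lemma Proj.isZero_iff_subsingleton (M : Proj Λ) : IsZero M ↔ Subsingleton M.obj := by
  constructor
  · intro h
    have : Proj.lin (𝟙 M) = Proj.lin 0 := congrArg _ (h.eq_of_src _ _)
    exact ⟨fun x y => (LinearMap.congr_fun this x).trans (LinearMap.congr_fun this y).symm⟩
  · intro h
    rw [IsZero.iff_id_eq_zero]
    exact Proj.lin_injective (LinearMap.ext fun x => Subsingleton.elim _ _)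

/-- The length of a finitely generated projective module (meaningful when `Λ` is artinian). -/
noncomputable def Proj.length (M : Proj Λ) : ℕ := (Module.length Λᵐᵒᵖ M.obj).toNat

lemma End_pow_f {Z : Cpx Λ} (φ : Z ⟶ Z) (n : ℕ) (j : ℤ) :
    ((End.of φ ^ n).asHom).f j = (End.of (φ.f j) ^ n).asHom := by
  induction n with
  | zero => rfl
  | succ n ih =>
    rw [pow_succ, pow_succ]
    change φ.f j ≫ ((End.of φ ^ n).asHom).f j = _
    rw [ih]
    rfl

lemma Proj.lin_pow {M : Proj Λ} (f : M ⟶ M) (n : ℕ) :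
    Proj.lin (End.of f ^ n).asHom = (Proj.lin f : Module.End Λᵐᵒᵖ M.obj) ^ n := by
  induction n with
  | zero => rfl
  | succ n ih =>
    rw [pow_succ, pow_succ]
    change (Proj.lin (End.of f ^ n).asHom) ∘ₗ (Proj.lin f) = _
    rw [ih]
    rfl

section Artinian

variable [IsArtinianRing Λᵐᵒᵖ]

/-- The length is additive in split exact sequences. -/
lemma Proj.length_eq_add {M N B : Proj Λ} {i : M ⟶ B} {r : B ⟶ M} {s : N ⟶ B} {q : B ⟶ N}
    (hi : i ≫ r = 𝟙 M) (hs : s ≫ q = 𝟙 N) (h : r ≫ i + q ≫ s = 𝟙 B) :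
    B.length = M.length + N.length := by
  have hiq : i ≫ q = 0 := by
    have := congrArg (fun x => i ≫ x ≫ q) h
    simp only [Preadditive.add_comp, Preadditive.comp_add, Category.assoc, reassoc_of% hi, hs,
      Category.comp_id, Category.id_comp] at this
    simpa using this
  have := M.property.1
  have := N.property.1
  have := B.property.1
  have hi' : ∀ x, Proj.lin r (Proj.lin i x) = x := fun x =>
    LinearMap.congr_fun (congrArg Proj.lin hi) x
  have hs' : ∀ x, Proj.lin q (Proj.lin s x) = x := fun x =>
    LinearMap.congr_fun (congrArg Proj.lin hs) x
  have h' : ∀ x, Proj.lin i (Proj.lin r x) + Proj.lin s (Proj.lin q x) = x := fun x =>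
    LinearMap.congr_fun (congrArg Proj.lin h) x
  have hiq' : ∀ x, Proj.lin q (Proj.lin i x) = 0 := fun x =>
    LinearMap.congr_fun (congrArg Proj.lin hiq) x
  have hl := Module.length_eq_add_of_exact (Proj.lin i) (Proj.lin q)
    (Function.LeftInverse.injective hi') (Function.RightInverse.surjective hs')
    (fun y => ⟨fun hy => ⟨Proj.lin r y, by simpa [hy] using h' y⟩, by
      rintro ⟨x, rfl⟩
      exact hiq' x⟩)
  unfold Proj.length
  rw [hl, ENat.toNat_add Module.length_ne_top Module.length_ne_top]

lemma Proj.length_pos {M : Proj Λ} (h : ¬ IsZero M) : 0 < M.length := by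
  have := M.property.1
  rw [Proj.isZero_iff_subsingleton, not_subsingleton_iff_nontrivial] at h
  rw [Proj.length, Nat.pos_iff_ne_zero, Ne, ENat.toNat_eq_zero, not_or]
  exact ⟨Module.length_pos.ne', Module.length_ne_top⟩

/-- The module-theoretic form of Fitting's lemma: the large powers of an endomorphism have group
inverses. -/
lemma Proj.eventually_exists_groupInverse {M : Proj Λ} (f : M ⟶ M) :
    ∀ᶠ n in Filter.atTop, ∃ g : M ⟶ M, (End.of f ^ n).asHom ≫ g = g ≫ (End.of f ^ n).asHom ∧
      g ≫ (End.of f ^ n).asHom ≫ (End.of f ^ n).asHom = (End.of f ^ n).asHom := by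
  have := M.property.1
  filter_upwards [LinearMap.eventually_isCompl_ker_pow_range_pow
    (Proj.lin f : Module.End Λᵐᵒᵖ M.obj)] with n hn
  obtain ⟨g, h1, h2⟩ := exists_groupInverse_of_isCompl _ hn
  refine ⟨Proj.ofLin g, Proj.lin_injective ?_, Proj.lin_injective ?_⟩
  · change g * Proj.lin (End.of f ^ n).asHom = Proj.lin (End.of f ^ n).asHom * g
    rw [Proj.lin_pow, h1]
  · change (Proj.lin (End.of f ^ n).asHom * Proj.lin (End.of f ^ n).asHom) * g = _
    rw [Proj.lin_pow, mul_assoc, h2]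

end Artinian

end Algebra

/-! ### Idempotents and endomorphisms of indecomposable objects -/

section Indecomposable

variable {C : Type u} [Category.{v} C] [Preadditive C] [HasBinaryBiproducts C]

/-- The biproduct decomposition given by two retracts whose idempotents add up to the identity. -/
noncomputable def isoBiprodOfRetracts {X Y Z : C} {i : Y ⟶ X} {r : X ⟶ Y} {s : Z ⟶ X} {q : X ⟶ Z}
    (hi : i ≫ r = 𝟙 Y) (hs : s ≫ q = 𝟙 Z) (h : r ≫ i + q ≫ s = 𝟙 X) : X ≅ Y ⊞ Z where
  hom := biprod.lift r q
  inv := biprod.desc i s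
  hom_inv_id := by simpa using h
  inv_hom_id := by
    have h1 : i ≫ q = 0 := by
      have := congrArg (fun x => i ≫ x ≫ q) h
      simp only [Preadditive.add_comp, Preadditive.comp_add, Category.assoc, reassoc_of% hi, hs,
        Category.comp_id, Category.id_comp] at this
      simpa using this
    have h2 : s ≫ r = 0 := by
      have := congrArg (fun x => s ≫ x ≫ r) h
      simp only [Preadditive.add_comp, Preadditive.comp_add, Category.assoc, reassoc_of% hs, hi,
        Category.comp_id, Category.id_comp] at this
      simpa using this
    ext <;> simp [hi, hs, h1, h2]

lemma idempotent_eq_zero_or_id [IsIdempotentComplete C] {X : C} (hX : Indecomposable X)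
    (e : X ⟶ X) (he : e ≫ e = e) : e = 0 ∨ e = 𝟙 X := by
  obtain ⟨Y, i, r, hi, hr⟩ := IsIdempotentComplete.idempotents_split X e he
  obtain ⟨Z, s, q, hs, hq⟩ := IsIdempotentComplete.idempotents_split X (𝟙 X - e) (by simp [he])
  rcases hX.2 Y Z (isoBiprodOfRetracts hi hs (by rw [hr, hq]; abel)) with h | h
  · left
    rw [← hr, h.eq_of_src i 0, comp_zero]
  · right
    rw [h.eq_of_src s 0, comp_zero] at hq
    exact (sub_eq_zero.1 hq.symm).symm

end Indecomposable

section Algebra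

variable {Λ : Type u} [Ring Λ]

instance : HasBinaryBiproducts (Cpx Λ) := ⟨fun _ _ => inferInstance⟩

/-- `X` is supported in `[a, b]`: its cells outside this interval vanish. -/
def IsSupp (X : Cpx Λ) (a b : ℤ) : Prop := ∀ j : ℤ, j ∉ Set.Icc a b → IsZero (X.X j)

/-- A morphism `d` which intertwines two group-invertible endomorphisms `a` and `b` also intertwines
the idempotents attached to them. -/
lemma groupInverse_comm {C : Type*} [Category* C] [Preadditive C] {M N : C} {a g : M ⟶ M}
    {b k : N ⟶ N} {d : M ⟶ N} (hd : a ≫ d = d ≫ b) (h1 : a ≫ g = g ≫ a) (h2 : g ≫ a ≫ a = a)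
    (h3 : b ≫ k = k ≫ b) (h4 : k ≫ b ≫ b = b) : (a ≫ g) ≫ d = d ≫ b ≫ k := by
  have e1 : (g ≫ a) ≫ d = (g ≫ a) ≫ d ≫ (k ≫ b) := by
    have h4' : b ≫ k ≫ b = b := by rw [reassoc_of% h3, h4]
    simp only [Category.assoc]
    rw [reassoc_of% hd, hd, h4']
  have e2 : d ≫ b ≫ k = (g ≫ a) ≫ d ≫ b ≫ k := by
    simp only [Category.assoc]
    rw [← reassoc_of% hd, reassoc_of% h2]
  rw [e2, h1, h3]
  exact e1

/-- Fitting's lemma for bounded complexes. For a common large `n` the components of `φ ^ n` have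
group inverses; the idempotents attached to them form an endomorphism of the complex, which is `0`
or the identity. -/
lemma isFitting_of_indecomposable [IsArtinianRing Λᵐᵒᵖ] {Z : Cpx Λ} {a b : ℤ}
    (hab : IsSupp Z a b) (hZ : Indecomposable Z) : IsFitting Z := by
  intro φ
  have hev : ∀ᶠ n in Filter.atTop, ∀ j ∈ Finset.Icc a b, ∃ g : Z.X j ⟶ Z.X j,
      (End.of (φ.f j) ^ n).asHom ≫ g = g ≫ (End.of (φ.f j) ^ n).asHom ∧
      g ≫ (End.of (φ.f j) ^ n).asHom ≫ (End.of (φ.f j) ^ n).asHom =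
        (End.of (φ.f j) ^ n).asHom :=
    (Finset.eventually_all _).2 fun j _ => Proj.eventually_exists_groupInverse _
  obtain ⟨n, hn, hn1⟩ := (hev.and (Filter.eventually_ge_atTop 1)).exists
  have hn' : ∀ j, ∃ g : Z.X j ⟶ Z.X j,
      ((End.of φ ^ n).asHom).f j ≫ g = g ≫ ((End.of φ ^ n).asHom).f j ∧
      g ≫ ((End.of φ ^ n).asHom).f j ≫ ((End.of φ ^ n).asHom).f j =
        ((End.of φ ^ n).asHom).f j := by
    intro j
    by_cases hj : j ∈ Set.Icc a b
    · rw [End_pow_f]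
      exact hn j (Finset.mem_Icc.2 hj)
    -- outside the interval all morphisms are zero
    · exact ⟨0, (hab j hj).eq_of_src _ _, (hab j hj).eq_of_src _ _⟩
  choose g hg1 hg2 using hn'
  let α : Z ⟶ Z := (End.of φ ^ n).asHom
  let e : Z ⟶ Z :=
    { f := fun j => α.f j ≫ g j
      comm' := fun i j _ =>
        groupInverse_comm (α.comm i j) (hg1 i) (hg2 i) (hg1 j) (hg2 j) }
  have he : e ≫ e = e := by
    ext j : 1
    change (α.f j ≫ g j) ≫ α.f j ≫ g j = α.f j ≫ g j
    have h1 : (α.f j ≫ g j) ≫ α.f j = α.f j := by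
      rw [hg1 j, Category.assoc]
      exact hg2 j
    rw [← Category.assoc, h1]
  have hα : e ≫ α = α := by
    ext j : 1
    change (α.f j ≫ g j) ≫ α.f j = α.f j
    rw [hg1 j, Category.assoc]
    exact hg2 j
  -- if `e = 0` then `α = φ ^ n` is zero, and if `e = 𝟙` then `α` is invertible with inverse `g`
  rcases idempotent_eq_zero_or_id hZ e he with h | h
  · right
    exact ⟨n, by rw [h, zero_comp] at hα; exact hα.symm⟩
  · left
    have hα' : IsIso α := by
      have : ∀ j, IsIso (α.f j) := fun j => by
        have h' : α.f j ≫ g j = 𝟙 _ := congrArg (fun x => HomologicalComplex.Hom.f x j) h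
        exact ⟨g j, h', by rw [← hg1 j]; exact h'⟩
      exact HomologicalComplex.Hom.isIso_of_components α
    obtain ⟨m, rfl⟩ : ∃ m, n = m + 1 := ⟨n - 1, by omega⟩
    have c1 : φ ≫ (End.of φ ^ m).asHom = α := by
      change (End.of φ ^ m * End.of φ).asHom = _
      rw [← pow_succ]
    have c2 : (End.of φ ^ m).asHom ≫ φ = α := by
      change (End.of φ * End.of φ ^ m).asHom = _
      rw [← pow_succ']
    have : IsSplitMono φ := ⟨⟨⟨(End.of φ ^ m).asHom ≫ inv α, by
      rw [reassoc_of% c1, IsIso.hom_inv_id]⟩⟩⟩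
    have : Epi φ := by
      have : Epi ((End.of φ ^ m).asHom ≫ φ) := by rw [c2]; infer_instance
      exact epi_of_epi (End.of φ ^ m).asHom φ
    exact isIso_of_epi_of_isSplitMono φ

end Algebra

/-! ### The width of indecomposable complexes -/

open scoped ZeroObject

section Algebra

variable {Λ : Type u} [Ring Λ]

lemma isZero_X_of_retract {X Y : Cpx Λ} (i : X ⟶ Y) (r : Y ⟶ X) (h : i ≫ r = 𝟙 X) {j : ℤ}
    (hj : IsZero (Y.X j)) : IsZero (X.X j) := by
  rw [IsZero.iff_id_eq_zero]
  have := congrArg (fun x => HomologicalComplex.Hom.f x j) h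
  dsimp at this
  rw [← this, hj.eq_of_src (r.f j) 0, comp_zero]

lemma not_isZero_contractible {P : Proj Λ} (hP : ¬ IsZero P) (k : ℤ) :
    ¬ IsZero (contractible P k) := fun h =>
  hP (((HomologicalComplex.eval (Proj Λ) (ComplexShape.up ℤ) k).map_isZero h).of_iso
    (HomologicalComplex.doubleXIso₀ (c := ComplexShape.up ℤ) (𝟙 P) rfl).symm)

/-- A contractible summand `P → P` of an indecomposable complex would be all of it, so there is none
if two nonzero cells are at least two degrees apart. -/
lemma isEmpty_retract_contractible {Z : Cpx Λ} (hZ : Indecomposable Z) {a b : ℤ}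
    (ha : ¬ IsZero (Z.X a)) (hb : ¬ IsZero (Z.X b)) (hab : a + 2 ≤ b) {P : Proj Λ}
    (hP : ¬ IsZero P) (k : ℤ) : IsEmpty (Retract (contractible P k) Z) := by
  refine ⟨fun R => ?_⟩
  rcases idempotent_eq_zero_or_id hZ (R.r ≫ R.i) (by simp) with h | h
  · refine not_isZero_contractible hP k ((IsZero.iff_id_eq_zero _).2 ?_)
    have : R.i ≫ (R.r ≫ R.i) ≫ R.r = 𝟙 _ := by simp
    rw [← this, h, zero_comp, comp_zero]
  · have key : ∀ j, ¬ IsZero (Z.X j) → j = k ∨ j = k + 1 := by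
      intro j hj
      by_contra hjk
      rw [not_or] at hjk
      exact hj (isZero_X_of_retract R.r R.i h
        (HomologicalComplex.isZero_double_X (𝟙 P) rfl j hjk.1 hjk.2))
    have := key a ha
    have := key b hb
    omega

/-- If `Z` were contractible, the part of a contraction which ends in the first nonzero degree `a`
would be the homotopy of a nullhomotopic idempotent of `Z`, which is the identity in degree `a` and
vanishes in all degrees other than `a` and `a + 1`. -/
lemma not_homotopy_id_zero {Z : Cpx Λ} (hZ : Indecomposable Z) {a b : ℤ} (hs : IsSupp Z a b)
    (ha : ¬ IsZero (Z.X a)) (hb : ¬ IsZero (Z.X b)) (hab : a + 2 ≤ b) :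
    IsEmpty (Homotopy (𝟙 Z) 0) := by
  refine ⟨fun H => ?_⟩
  have h0 : Z.d a (a + 1) ≫ H.hom (a + 1) a = 𝟙 _ := by
    have h1 := H.comm a
    rw [dNext_eq _ (show (ComplexShape.up ℤ).Rel a (a + 1) from rfl),
      prevD_eq _ (show (ComplexShape.up ℤ).Rel (a - 1) a by simp),
      (hs (a - 1) (by simp)).eq_of_tgt (H.hom a (a - 1)) 0] at h1
    simpa using h1.symm
  let k : ∀ i j, (ComplexShape.up ℤ).Rel j i → (Z.X i ⟶ Z.X j) := fun i j _ =>
    if j = a then H.hom i j else 0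
  let e := Homotopy.nullHomotopicMap' k
  have he : ∀ j, e.f j = Z.d j (j + 1) ≫ k (j + 1) j rfl +
      k j (j - 1) (by simp) ≫ Z.d (j - 1) j := fun j =>
    Homotopy.nullHomotopicMap'_f (by simp) rfl k
  have hea : e.f a = 𝟙 _ := by
    rw [he]
    simp [k, h0]
  have hne : ∀ j, j ≠ a → j ≠ a + 1 → e.f j = 0 := by
    intro j h1 h2
    rw [he]
    simp [k, h1, show j - 1 ≠ a by omega]
  have hidem : e ≫ e = e := by
    ext j : 1
    rw [HomologicalComplex.comp_f]
    by_cases h1 : j = a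
    · subst h1
      rw [hea, Category.comp_id]
    · by_cases h2 : j = a + 1
      · have h3 : e.f (a + 1) = H.hom (a + 1) a ≫ Z.d a (a + 1) := by
          have := Homotopy.nullHomotopicMap'_f (k₂ := a) (k₁ := a + 1) (k₀ := a + 1 + 1)
            (c := ComplexShape.up ℤ) rfl rfl k
          rw [show e.f (a + 1) = _ from this]
          simp [k]
        subst h2
        rw [h3, Category.assoc, reassoc_of% h0]
      · rw [hne j h1 h2, comp_zero]
  rcases idempotent_eq_zero_or_id hZ e hidem with h | h
  · apply ha
    rw [IsZero.iff_id_eq_zero, ← hea, h]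
    rfl
  · apply hb
    rw [IsZero.iff_id_eq_zero, ← hne b (by omega) (by omega), h]
    rfl

/-- The homotopy class of a bounded complex. -/
noncomputable def toKb {Z : Cpx Λ} {a b : ℤ} (hs : IsSupp Z a b) : Kb Λ :=
  ⟨(HomotopyCategory.quotient (Proj Λ) (ComplexShape.up ℤ)).obj Z, ⟨Z, ⟨a, b, hs⟩⟩⟩

/-- A splitting of the homotopy class of `Z` gives an idempotent up to homotopy. It is represented
by an endomorphism of `Z` which is invertible or nilpotent, so it is the identity or zero. -/
lemma indecomposable_toKb [IsArtinianRing Λᵐᵒᵖ] {Z : Cpx Λ} (hZ : Indecomposable Z) {a b : ℤ}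
    (hs : IsSupp Z a b) (h0 : IsEmpty (Homotopy (𝟙 Z) 0)) : Indecomposable (toKb hs) := by
  let Q := HomotopyCategory.quotient (Proj Λ) (ComplexShape.up ℤ)
  refine ⟨fun h => ?_, fun Y Y' e => ?_⟩
  · have h1 : Q.map (𝟙 Z) = Q.map 0 := congrArg (fun x => x.hom) (h.eq_of_src (𝟙 (toKb hs)) 0)
    exact h0.false (HomotopyCategory.homotopyOfEq _ _ h1)
  · let ε : toKb hs ⟶ toKb hs := e.hom ≫ biprod.fst ≫ biprod.inl ≫ e.inv
    have hε : ε ≫ ε = ε := by simp [ε]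
    obtain ⟨φ, hφ⟩ : ∃ φ : Z ⟶ Z, Q.map φ = ε.hom := Q.map_surjective ε.hom
    rcases isFitting_of_indecomposable hs hZ φ with h | ⟨n, h⟩
    · right
      have : IsIso ε.hom := by rw [← hφ]; exact Functor.map_isIso Q φ
      have : IsIso ε := (ObjectProperty.isIso_hom_iff ε).1 this
      have h1 : ε = 𝟙 _ := by rw [← cancel_mono ε, hε, Category.id_comp]
      rw [IsZero.iff_id_eq_zero]
      have : (biprod.inr ≫ e.inv) ≫ ε ≫ e.hom ≫ biprod.snd = 𝟙 Y' := by rw [h1]; simp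
      rw [← this]
      simp [ε]
    · left
      have h2 : ∀ m : ℕ, Q.map (End.of φ ^ m).asHom = (End.of ε ^ m).asHom.hom := by
        intro m
        induction m with
        | zero => exact Q.map_id Z
        | succ m ih =>
          rw [pow_succ, pow_succ]
          change Q.map (φ ≫ (End.of φ ^ m).asHom) = (ε ≫ (End.of ε ^ m).asHom).hom
          rw [Q.map_comp, ih, hφ]
          rfl
      have h3 : ∀ m : ℕ, (End.of ε ^ (m + 1)).asHom = ε := by
        intro m
        induction m with
        | zero => rw [zero_add, pow_one]
        | succ m ih =>
          rw [pow_succ]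
          change ε ≫ (End.of ε ^ (m + 1)).asHom = ε
          rw [ih, hε]
      have h4 : ε = 0 := by
        have h5 : (End.of ε ^ n).asHom = 0 := by
          apply ObjectProperty.hom_ext
          rw [← h2, h, Q.map_zero]
          rfl
        rw [← h3 n, pow_succ]
        change ε ≫ (End.of ε ^ n).asHom = 0
        rw [h5, comp_zero]
      rw [IsZero.iff_id_eq_zero]
      have : (biprod.inl ≫ e.inv) ≫ ε ≫ e.hom ≫ biprod.fst = 𝟙 Y := by simp [ε]
      rw [← this, h4]
      simp

/-- An indecomposable complex is not wider than the strong global dimension. The bound `1 ≤ η` rules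
out the contractible complexes `P → P`, which are indecomposable of width `1`, but zero up to
homotopy. -/
lemma isZero_or_isZero_of_indecomposable [IsArtinianRing Λᵐᵒᵖ] {η : ℕ} (hη : 1 ≤ η)
    (hΛ : strongGlobalDimension Λ = η) {Z : Cpx Λ} {a b : ℤ} (hs : IsSupp Z a b)
    (hZ : Indecomposable Z) (hab : (η : ℤ) < b - a) : IsZero (Z.X a) ∨ IsZero (Z.X b) := by
  by_contra hcon
  rw [not_or] at hcon
  obtain ⟨ha, hb⟩ := hcon
  have hab2 : a + 2 ≤ b := by omega
  have hind := indecomposable_toKb hZ hs (not_homotopy_id_zero hZ hs ha hb hab2)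
  obtain ⟨l, hl⟩ : ∃ l : ℕ, a + l = b := ⟨(b - a).toNat, by omega⟩
  have hlen : HasLength (toKb hs) l := by
    refine ⟨Z, ⟨⟨Iso.refl _⟩, fun P k hP =>
      isEmpty_retract_contractible hZ ha hb hab2 hP.1 k⟩, a, ha, ?_, ?_⟩
    · rw [hl]; exact hb
    · rw [hl]; exact hs
  have : (l : ℕ∞) ≤ η := by
    rw [← hΛ]
    exact le_sSup ⟨toKb hs, l, hind, hlen, rfl⟩
  have : l ≤ η := by exact_mod_cast this
  omega

/-! ### Splitting wide complexes -/

lemma IsSupp.mono {X : Cpx Λ} {a b c d : ℤ} (h : IsSupp X a b) (hc : c ≤ a) (hd : b ≤ d) :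
    IsSupp X c d := fun j hj => h j fun h' => hj ⟨by have := h'.1; omega, by have := h'.2; omega⟩

lemma IsSupp.biprod {X Y : Cpx Λ} {a b : ℤ} (hX : IsSupp X a b) (hY : IsSupp Y a b) :
    IsSupp (X ⊞ Y) a b := fun j hj => isZero_biprod_X (hX j hj) (hY j hj)

lemma IsSupp.of_retract {X Y : Cpx Λ} {a b : ℤ} (hY : IsSupp Y a b) (i : X ⟶ Y) (r : Y ⟶ X)
    (h : i ≫ r = 𝟙 X) : IsSupp X a b := fun j hj => isZero_X_of_retract i r h (hY j hj)

lemma IsSupp.erase_left {X : Cpx Λ} {a b : ℤ} (hX : IsSupp X a b) (ha : IsZero (X.X a)) :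
    IsSupp X (a + 1) b := fun j hj => by
  by_cases h : j = a
  · exact h ▸ ha
  · exact hX j fun h' => hj ⟨by have := h'.1; omega, h'.2⟩

lemma IsSupp.erase_right {X : Cpx Λ} {a b : ℤ} (hX : IsSupp X a b) (hb : IsZero (X.X b)) :
    IsSupp X a (b - 1) := fun j hj => by
  by_cases h : j = b
  · exact h ▸ hb
  · exact hX j fun h' => hj ⟨h'.1, by have := h'.2; omega⟩

lemma biprod_map_comp_map_eq_id {C : Type*} [Category* C] [Preadditive C] [HasBinaryBiproducts C]
    {A B Y Z : C} {i : A ⟶ Y} {p : Y ⟶ A} {k : B ⟶ Z} {q : Z ⟶ B} (h : i ≫ p = 𝟙 A)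
    (h' : k ≫ q = 𝟙 B) : biprod.map i k ≫ biprod.map p q = 𝟙 (A ⊞ B) := by
  ext <;> simp [h, h']

lemma biprod_map_add_map_eq_id {C : Type*} [Category* C] [Preadditive C] [HasBinaryBiproducts C]
    {A A' B B' Y Z : C} {i : A ⟶ Y} {p : Y ⟶ A} {i' : A' ⟶ Y} {p' : Y ⟶ A'} {k : B ⟶ Z}
    {q : Z ⟶ B} {k' : B' ⟶ Z} {q' : Z ⟶ B'} (h : p ≫ i + p' ≫ i' = 𝟙 Y)
    (h' : q ≫ k + q' ≫ k' = 𝟙 Z) :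
    biprod.map p q ≫ biprod.map i k + biprod.map p' q' ≫ biprod.map i' k' = 𝟙 (Y ⊞ Z) := by
  ext <;> simp [h, h']

/-- A complex supported in an interval of width more than the strong global dimension is the direct
sum of a complex which vanishes at the right end of the interval and one which vanishes at the left
end. -/
lemma exists_splitting [IsArtinianRing Λᵐᵒᵖ] {η : ℕ} (hη : 1 ≤ η)
    (hΛ : strongGlobalDimension Λ = η) {Z : Cpx Λ} {a b : ℤ} (hs : IsSupp Z a b)
    (hab : (η : ℤ) < b - a) :
    ∃ (Z₁ Z₂ : Cpx Λ) (i₁ : Z₁ ⟶ Z) (p₁ : Z ⟶ Z₁) (i₂ : Z₂ ⟶ Z) (p₂ : Z ⟶ Z₂),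
      IsSupp Z₁ a (b - 1) ∧ IsSupp Z₂ (a + 1) b ∧ i₁ ≫ p₁ = 𝟙 _ ∧ i₂ ≫ p₂ = 𝟙 _ ∧
        p₁ ≫ i₁ + p₂ ≫ i₂ = 𝟙 Z := by
  obtain ⟨N, hN⟩ : ∃ N, ∑ j ∈ Finset.Icc a b, (Z.X j).length = N := ⟨_, rfl⟩
  induction N using Nat.strong_induction_on generalizing Z with
  | _ N ih =>
    by_cases h0 : IsZero Z
    · have hz := fun j => (HomologicalComplex.eval (Proj Λ) (ComplexShape.up ℤ) j).map_isZero h0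
      exact ⟨Z, Z, 𝟙 _, 𝟙 _, 𝟙 _, 𝟙 _, fun j _ => hz j, fun j _ => hz j, by simp, by simp,
        h0.eq_of_src _ _⟩
    by_cases hZ : Indecomposable Z
    · rcases isZero_or_isZero_of_indecomposable hη hΛ hs hZ hab with h | h
      · have hz : ∀ j, IsZero ((0 : Cpx Λ).X j) := fun j =>
          (HomologicalComplex.eval (Proj Λ) (ComplexShape.up ℤ) j).map_isZero (isZero_zero _)
        exact ⟨0, Z, 0, 0, 𝟙 _, 𝟙 _, fun j _ => hz j, hs.erase_left h,
          (isZero_zero _).eq_of_src _ _, by simp, by simp⟩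
      · have hz : ∀ j, IsZero ((0 : Cpx Λ).X j) := fun j =>
          (HomologicalComplex.eval (Proj Λ) (ComplexShape.up ℤ) j).map_isZero (isZero_zero _)
        exact ⟨Z, 0, 𝟙 _, 𝟙 _, 0, 0, hs.erase_right h, fun j _ => hz j,
          by simp, (isZero_zero _).eq_of_src _ _, by simp⟩
    · simp only [Indecomposable, not_and, not_forall] at hZ
      obtain ⟨Y, Y', e, hYY⟩ := hZ h0
      rw [not_or] at hYY
      have hr : (biprod.inl ≫ e.inv) ≫ (e.hom ≫ biprod.fst) = 𝟙 Y := by simp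
      have hr' : (biprod.inr ≫ e.inv) ≫ (e.hom ≫ biprod.snd) = 𝟙 Y' := by simp
      have htot : (e.hom ≫ biprod.fst) ≫ (biprod.inl ≫ e.inv) +
          (e.hom ≫ biprod.snd) ≫ (biprod.inr ≫ e.inv) = 𝟙 Z := by
        calc _ = e.hom ≫ (biprod.fst ≫ biprod.inl + biprod.snd ≫ biprod.inr) ≫ e.inv := by
              simp only [Preadditive.add_comp, Preadditive.comp_add, Category.assoc]
          _ = 𝟙 Z := by rw [biprod.total, Category.id_comp, e.hom_inv_id]
      have hY := hs.of_retract _ _ hr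
      have hY' := hs.of_retract _ _ hr'
      have hl : ∀ j, (Z.X j).length = (Y.X j).length + (Y'.X j).length := fun j =>
        Proj.length_eq_add (congrArg (fun x => HomologicalComplex.Hom.f x j) hr)
          (congrArg (fun x => HomologicalComplex.Hom.f x j) hr')
          (congrArg (fun x => HomologicalComplex.Hom.f x j) htot)
      have hsum := Finset.sum_congr (rfl : Finset.Icc a b = Finset.Icc a b) fun j _ => hl j
      rw [Finset.sum_add_distrib, hN] at hsum
      have hpos : ∀ {X : Cpx Λ}, IsSupp X a b → ¬ IsZero X →
          0 < ∑ j ∈ Finset.Icc a b, (X.X j).length := by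
        intro X hX hX0
        by_contra hcon
        apply hX0
        rw [IsZero.iff_id_eq_zero]
        ext j : 1
        refine IsZero.eq_of_src ?_ _ _
        by_cases hj : j ∈ Set.Icc a b
        · by_contra hj0
          have := Finset.single_le_sum (f := fun j => (X.X j).length) (fun _ _ => Nat.zero_le _)
            (Finset.mem_Icc.2 hj)
          have := Proj.length_pos hj0
          omega
        · exact hX j hj
      have := hpos hY hYY.1
      have := hpos hY' hYY.2
      obtain ⟨A₁, A₂, i₁, p₁, i₂, p₂, s1, s2, e1, e2, e3⟩ := ih _ (by omega) hY rfl
      obtain ⟨B₁, B₂, k₁, q₁, k₂, q₂, t1, t2, f1, f2, f3⟩ := ih _ (by omega) hY' rfl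
      refine ⟨A₁ ⊞ B₁, A₂ ⊞ B₂, biprod.map i₁ k₁ ≫ e.inv, e.hom ≫ biprod.map p₁ q₁,
        biprod.map i₂ k₂ ≫ e.inv, e.hom ≫ biprod.map p₂ q₂, s1.biprod t1, s2.biprod t2, ?_, ?_, ?_⟩
      · simp [biprod_map_comp_map_eq_id e1 f1]
      · simp [biprod_map_comp_map_eq_id e2 f2]
      · calc _ = e.hom ≫ (biprod.map p₁ q₁ ≫ biprod.map i₁ k₁ +
              biprod.map p₂ q₂ ≫ biprod.map i₂ k₂) ≫ e.inv := by
              simp only [Preadditive.add_comp, Preadditive.comp_add, Category.assoc]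
          _ = 𝟙 Z := by
              rw [biprod_map_add_map_eq_id e3 f3, Category.id_comp, e.hom_inv_id]

end Algebra

/-! ### Trimming contractible ends -/

section Trim

variable {C : Type*} [Category* C] [Preadditive C] [IsIdempotentComplete C]

/-- If `A` is contractible in the degrees greater than `b`, the contractible part can be split off:
there is a direct summand `W` of `A` which vanishes in these degrees, and each morphism to `A` from
a complex which vanishes in these degrees has its image in `W`. The complement of `W` is the image
of the idempotent whose homotopy is the part of `h` which ends in the degrees at least `b`. -/
lemma exists_trim (A : CochainComplex C ℤ) (b : ℤ) (h : ∀ i j : ℤ, A.X i ⟶ A.X j)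
    (hh : ∀ j, b < j → A.d j (j + 1) ≫ h (j + 1) j + h j (j - 1) ≫ A.d (j - 1) j = 𝟙 _) :
    ∃ (W : CochainComplex C ℤ) (i : W ⟶ A) (p : A ⟶ W), i ≫ p = 𝟙 W ∧
      (∀ j, b < j → IsZero (W.X j)) ∧
      ∀ (U : CochainComplex C ℤ) (_ : ∀ j, b < j → IsZero (U.X j)) (u : U ⟶ A),
        u ≫ p ≫ i = u := by
  let k : ∀ i j, (ComplexShape.up ℤ).Rel j i → (A.X i ⟶ A.X j) := fun i j _ =>
    if b ≤ j then h i j else 0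
  let ν := Homotopy.nullHomotopicMap' k
  have hν : ∀ j, ν.f j = A.d j (j + 1) ≫ k (j + 1) j rfl +
      k j (j - 1) (by simp) ≫ A.d (j - 1) j := fun j =>
    Homotopy.nullHomotopicMap'_f (by simp) rfl k
  have h1 : ∀ j, b < j → ν.f j = 𝟙 _ := fun j hj => by
    rw [hν, ← hh j hj]
    simp [k, show b ≤ j by omega, show b ≤ j - 1 by omega]
  have h2 : ∀ j, j < b → ν.f j = 0 := fun j hj => by
    rw [hν]
    simp [k, show ¬ b ≤ j by omega, show ¬ b ≤ j - 1 by omega]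
  have h3 : ν.f b = A.d b (b + 1) ≫ h (b + 1) b := by
    rw [hν]
    simp [k]
  have hid : ν ≫ ν = ν := by
    ext j : 1
    rw [HomologicalComplex.comp_f]
    rcases lt_trichotomy j b with hj | rfl | hj
    · rw [h2 j hj, comp_zero]
    · have := ν.comm j (j + 1)
      rw [h1 (j + 1) (by omega), Category.comp_id] at this
      nth_rw 2 [h3]
      rw [reassoc_of% this, ← h3]
    · rw [h1 j hj, Category.comp_id]
  obtain ⟨W, i, p, hi, hp⟩ := IsIdempotentComplete.idempotents_split A (𝟙 A - ν) (by simp [hid])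
  refine ⟨W, i, p, hi, fun j hj => ?_, fun U hU u => ?_⟩
  · have h4 : p.f j ≫ i.f j = 0 := by
      rw [← HomologicalComplex.comp_f, hp]
      simp [h1 j hj]
    have h5 : i.f j ≫ p.f j = 𝟙 _ := by
      rw [← HomologicalComplex.comp_f, hi]
      rfl
    have h6 : i.f j ≫ (p.f j ≫ i.f j) ≫ p.f j = 𝟙 _ := by
      rw [Category.assoc, h5, Category.comp_id, h5]
    rw [IsZero.iff_id_eq_zero, ← h6, h4, zero_comp, comp_zero]
  · rw [hp, Preadditive.comp_sub, Category.comp_id, sub_eq_self]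
    ext j : 1
    rw [HomologicalComplex.comp_f]
    rcases lt_trichotomy j b with hj | rfl | hj
    · rw [h2 j hj, comp_zero]
      rfl
    · rw [h3, u.comm_assoc, (hU (j + 1) (by omega)).eq_of_tgt (U.d j (j + 1)) 0, zero_comp]
      rfl
    · exact (hU j hj).eq_of_src _ _

end Trim

/-! ### Morphisms between complexes supported in shifted intervals -/

section Algebra

open CochainComplex CochainComplex.HomComplex

variable {Λ : Type u} [Ring Λ]

lemma isSupp_mappingCone {U F : Cpx Λ} (φ : U ⟶ F) {a b : ℤ} (hU : IsSupp U (a + 1) (b + 1))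
    (hF : IsSupp F a b) : IsSupp (mappingCone φ) a b := fun j hj => by
  rw [IsZero.iff_id_eq_zero, ← mappingCone.id_X φ j (j + 1) rfl,
    (hF j hj).eq_of_tgt ((mappingCone.snd φ).v j j (add_zero j)) 0,
    (hU (j + 1) fun h => hj ⟨by have := h.1; omega, by have := h.2; omega⟩).eq_of_tgt
      ((mappingCone.fst φ).1.v j (j + 1) rfl) 0, zero_comp, zero_comp, zero_add]

lemma isSupp_mappingCocone {F G : Cpx Λ} (ψ : F ⟶ G) {a b : ℤ} (hF : IsSupp F a b)
    (hG : IsSupp G (a - 1) (b - 1)) : IsSupp (mappingCocone ψ) a b := fun j hj => by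
  rw [IsZero.iff_id_eq_zero, ← mappingCocone.id_X ψ j (j + -1) rfl,
    (hF j hj).eq_of_tgt ((mappingCocone.fst ψ).f j) 0,
    (hG (j + -1) fun h => hj ⟨by have := h.1; omega, by have := h.2; omega⟩).eq_of_tgt
      ((mappingCocone.snd ψ).v j (j + -1) rfl) 0, zero_comp, zero_comp, zero_add]

lemma mappingCocone_ext_to {F G : Cpx Λ} (ψ : F ⟶ G) (p q : ℤ) (hpq : p + -1 = q) {M : Proj Λ}
    {f g : M ⟶ (mappingCocone ψ).X p}
    (h1 : f ≫ (mappingCocone.fst ψ).f p = g ≫ (mappingCocone.fst ψ).f p)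
    (h2 : f ≫ (mappingCocone.snd ψ).v p q hpq = g ≫ (mappingCocone.snd ψ).v p q hpq) : f = g := by
  rw [← Category.comp_id f, ← Category.comp_id g, ← mappingCocone.id_X ψ p q hpq]
  simp only [Preadditive.comp_add, reassoc_of% h1, reassoc_of% h2]

/-- The differential of the mapping cocone, followed by the projection to the shifted target. -/
lemma mappingCocone_d_snd {F G : Cpx Λ} (ψ : F ⟶ G) (p q r : ℤ) (hpq : p + 1 = q) (hr : r + 1 = p) :
    (mappingCocone ψ).d p q ≫ (mappingCocone.snd ψ).v q p (by omega) =
      -((mappingCocone.snd ψ).v p r (by omega) ≫ G.d r p) -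
        (mappingCocone.fst ψ).f p ≫ ψ.f p := by
  have h1 : mappingCocone.snd ψ =
      mappingCocone.descCochain ψ (0 : Cochain F G (-1)) (Cochain.ofHom (𝟙 G)) (by norm_num) := by
    refine Cochain.ext _ _ fun i j hij => ?_
    rw [← cancel_epi (𝟙 _), ← mappingCocone.id_X ψ i j hij]
    simp only [Preadditive.add_comp, Category.assoc]
    rw [mappingCocone.inl_v_snd_v, mappingCocone.inr_v_snd_v, mappingCocone.inl_v_descCochain_v,
      mappingCocone.inr_v_descCochain_v ψ _ _ _ j i (by omega) j hij]
    simp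
  have h2 := mappingCocone.δ_descCochain ψ (0 : Cochain F G (-1)) (Cochain.ofHom (𝟙 G))
    (by norm_num) 1 (by norm_num)
  rw [← h1] at h2
  -- the differential of the cochain `mappingCocone.snd ψ`, written out in degree `p`
  have h3 := Cochain.congr_v h2 p p (add_zero p)
  rw [δ_v (-1) 0 (by norm_num) _ p p (add_zero p) r q (by omega) (by omega)] at h3
  simp at h3
  rw [eq_sub_of_add_eq' h3]
  abel

/-- A morphism between complexes supported in `[a, b]` and in `[a + 1, b + 1]` factors through a
complex supported in `[a + 1, b]` if the intervals are wide enough. -/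
theorem exists_factorization [IsArtinianRing Λᵐᵒᵖ] {η : ℕ} (hη : 1 ≤ η)
    (hΛ : strongGlobalDimension Λ = η) {U F : Cpx Λ} (φ : U ⟶ F) {a b : ℤ}
    (hU : IsSupp U a b) (hF : IsSupp F (a + 1) (b + 1)) (hab : (η : ℤ) ≤ b - a + 1) :
    ∃ (W : Cpx Λ) (x : U ⟶ W) (y : W ⟶ F), IsSupp W (a + 1) b ∧ x ≫ y = φ := by
  have hC : IsSupp (mappingCone φ) (a - 1) (b + 1) :=
    isSupp_mappingCone φ (hU.mono (by omega) (by omega)) (hF.mono (by omega) (by omega))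
  obtain ⟨C₁, C₂, i₁, p₁, i₂, p₂, hC₁, hC₂, e1, e2, e3⟩ :=
    exists_splitting hη hΛ hC (by omega)
  -- `φ` factors through the mapping cocone of `ψ`, because `U ⟶ F ⟶ C₂` is nullhomotopic
  let ψ : F ⟶ C₂ := mappingCone.inr φ ≫ p₂
  have hA : IsSupp (mappingCocone ψ) (a + 1) (b + 2) :=
    isSupp_mappingCocone ψ (hF.mono (by omega) (by omega)) (hC₂.mono (by omega) (by omega))
  let u : U ⟶ mappingCocone ψ := mappingCocone.lift ψ φ
    (-((mappingCone.inl φ).comp (Cochain.ofHom p₂) (add_zero (-1)))) (by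
      simp [ψ, mappingCone.δ_inl, Cochain.ofHom_comp])
  have hu : u ≫ mappingCocone.fst ψ = φ := by simp [u]
  -- `σ` is inverse to `ψ` in the degrees greater than `b`, and in degree `b` it is a section of
  -- `ψ`, which is all that the contraction of the cocone needs there
  let σ : ∀ j, C₂.X j ⟶ F.X j := fun j => i₂.f j ≫ (mappingCone.snd φ).v j j (add_zero j)
  have hfst : ∀ j, b ≤ j → (mappingCone.fst φ).1.v j (j + 1) rfl = 0 := fun j hj =>
    (hU (j + 1) fun h => by have := h.2; omega).eq_of_tgt _ _
  have hψσ : ∀ j, b < j → ψ.f j ≫ σ j = 𝟙 _ := fun j hj => by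
    have h : p₂.f j ≫ i₂.f j = 𝟙 _ := by
      have := congrArg (fun x => HomologicalComplex.Hom.f x j) e3
      dsimp at this
      rw [← this, (hC₁ j fun h => by have := h.2; omega).eq_of_tgt (p₁.f j) 0, zero_comp, zero_add]
    simp [ψ, σ, reassoc_of% h]
  have hσψ : ∀ j, b ≤ j → σ j ≫ ψ.f j = 𝟙 _ := fun j hj => by
    have h := mappingCone.id_X φ j (j + 1) rfl
    rw [hfst j hj, zero_comp, zero_add] at h
    simp only [ψ, σ, HomologicalComplex.comp_f, Category.assoc]
    rw [reassoc_of% h, ← HomologicalComplex.comp_f, e2]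
    rfl
  have hσd : ∀ j, b ≤ j → σ j ≫ F.d j (j + 1) = C₂.d j (j + 1) ≫ σ (j + 1) := fun j hj => by
    simp only [σ, Category.assoc]
    rw [← i₂.comm_assoc, mappingCone.d_snd_v φ j (j + 1) rfl, hfst j hj, zero_comp, zero_add]
  -- the contraction of the cocone sends the summand `C₂.X j` of the cell `j + 1` to `F.X j` by `-σ`
  let h : ∀ i j : ℤ, (mappingCocone ψ).X i ⟶ (mappingCocone ψ).X j := fun i j =>
    if hij : i + -1 = j then -((mappingCocone.snd ψ).v i j hij ≫ σ j ≫
      (mappingCocone.inl ψ).v j j (add_zero j)) else 0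
  have hh : ∀ i j (hij : i + -1 = j), h i j = -((mappingCocone.snd ψ).v i j hij ≫ σ j ≫
      (mappingCocone.inl ψ).v j j (add_zero j)) := fun i j hij => dif_pos hij
  obtain ⟨W, i, p, hip, hW, hWu⟩ := exists_trim (mappingCocone ψ) b h (fun j hj => by
    rw [hh (j + 1) j (by omega), hh j (j - 1) (by omega)]
    have hd := mappingCocone_d_snd ψ j (j + 1) (j - 1) rfl (by omega)
    have hσd' := hσd (j - 1) (by omega)
    rw [sub_add_cancel] at hσd'
    refine mappingCocone_ext_to ψ j (j - 1) (by omega) ?_ ?_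
    · simp only [Preadditive.add_comp, Preadditive.neg_comp, Preadditive.comp_neg, Category.assoc,
        mappingCocone.inl_v_fst_f, Category.comp_id, Category.id_comp]
      rw [reassoc_of% hd, ← (mappingCocone.fst ψ).comm, mappingCocone.inl_v_fst_f_assoc, hσd']
      simp [hψσ j hj]
    · have hd' := mappingCocone_d_snd ψ (j - 1) j (j - 2) (by omega) (by omega)
      simp only [Preadditive.add_comp, Preadditive.neg_comp, Preadditive.comp_neg, Category.assoc,
        mappingCocone.inl_v_snd_v, Category.id_comp, comp_zero]
      rw [hd']
      simp [hσψ (j - 1) (by omega)])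
  refine ⟨W, u ≫ p, i ≫ mappingCocone.fst ψ, fun j hj => ?_, ?_⟩
  · by_cases hjb : b < j
    · exact hW j hjb
    · exact isZero_X_of_retract i p hip (hA j fun h => hj ⟨h.1, by omega⟩)
  · have := hWu U (fun j hj => hU j fun h => by have := h.2; omega) u
    rw [← hu, ← this]
    simp [reassoc_of% hip]

end Algebra

/-! ### Functors which reflect or preserve irreducible and almost split morphisms -/

section Morphisms

variable {C D : Type*} [Category* C] [Category* D] (F : C ⥤ D) [F.Full] [F.Faithful]
  {X Y : C} {f : X ⟶ Y} {X' Y' : D} {f' : X' ⟶ Y'} (a : F.obj X ≅ X') (b : F.obj Y ≅ Y')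

lemma isSplitMono_map_iff_of_iso (h : F.map f ≫ b.hom = a.hom ≫ f') :
    IsSplitMono f ↔ IsSplitMono f' := by
  constructor
  · rintro ⟨⟨r, hr⟩⟩
    exact ⟨⟨⟨b.inv ≫ F.map r ≫ a.hom, by
      rw [← cancel_epi a.hom, ← reassoc_of% h, b.hom_inv_id_assoc, ← F.map_comp_assoc, hr]
      simp⟩⟩⟩
  · rintro ⟨⟨r, hr⟩⟩
    exact ⟨⟨⟨F.preimage (b.hom ≫ r ≫ a.inv), F.map_injective (by
      rw [F.map_comp, F.map_preimage, reassoc_of% h, reassoc_of% hr]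
      simp)⟩⟩⟩

lemma isSplitEpi_map_iff_of_iso (h : F.map f ≫ b.hom = a.hom ≫ f') :
    IsSplitEpi f ↔ IsSplitEpi f' := by
  constructor
  · rintro ⟨⟨s, hs⟩⟩
    exact ⟨⟨⟨b.inv ≫ F.map s ≫ a.hom, by
      rw [Category.assoc, Category.assoc, ← h, ← F.map_comp_assoc, hs]
      simp⟩⟩⟩
  · rintro ⟨⟨s, hs⟩⟩
    exact ⟨⟨⟨F.preimage (b.hom ≫ s ≫ a.inv), F.map_injective (by
      rw [F.map_comp, F.map_preimage, ← cancel_mono b.hom]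
      simp [h, hs])⟩⟩⟩

/-- A fully faithful functor reflects irreducible morphisms. The morphism in the target is only
given up to isomorphism, so that the lemma applies to truncations. -/
lemma IsIrreducible.of_map_iso (h : F.map f ≫ b.hom = a.hom ≫ f') (hf : IsIrreducible f') :
    IsIrreducible f := by
  refine ⟨fun h' => hf.1 ((isSplitMono_map_iff_of_iso F a b h).1 h'),
    fun h' => hf.2.1 ((isSplitEpi_map_iff_of_iso F a b h).1 h'), fun W g k hgk => ?_⟩
  refine (hf.2.2 (F.obj W) (a.inv ≫ F.map g) (F.map k ≫ b.hom) ?_).imp ?_ ?_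
  · rw [Category.assoc, ← F.map_comp_assoc, hgk, h, a.inv_hom_id_assoc]
  · exact (isSplitMono_map_iff_of_iso F a (Iso.refl _) (by simp)).2
  · exact (isSplitEpi_map_iff_of_iso F (Iso.refl _) b (by simp)).2

lemma IsMinimalLeftAlmostSplit.of_map_iso (h : F.map f ≫ b.hom = a.hom ≫ f')
    (hf : IsMinimalLeftAlmostSplit f') : IsMinimalLeftAlmostSplit f := by
  refine ⟨fun h' => hf.1 ((isSplitMono_map_iff_of_iso F a b h).1 h'), fun W u hu => ?_,
    fun u hu => ?_⟩
  · obtain ⟨s, hs⟩ := hf.2.1 (F.obj W) (a.inv ≫ F.map u) fun h' =>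
      hu ((isSplitMono_map_iff_of_iso F a (Iso.refl _) (by simp)).2 h')
    refine ⟨F.preimage (b.hom ≫ s), F.map_injective ?_⟩
    rw [F.map_comp, F.map_preimage, reassoc_of% h, hs, a.hom_inv_id_assoc]
  · have := hf.2.2 (b.inv ≫ F.map u ≫ b.hom) (by
      rw [← cancel_epi a.hom, ← reassoc_of% h, b.hom_inv_id_assoc, ← F.map_comp_assoc, hu, h])
    have h1 : F.map u = b.hom ≫ (b.inv ≫ F.map u ≫ b.hom) ≫ b.inv := by simp
    have : IsIso (F.map u) := by rw [h1]; infer_instance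
    exact isIso_of_reflects_iso u F

lemma IsMinimalRightAlmostSplit.of_map_iso (h : F.map f ≫ b.hom = a.hom ≫ f')
    (hf : IsMinimalRightAlmostSplit f') : IsMinimalRightAlmostSplit f := by
  refine ⟨fun h' => hf.1 ((isSplitEpi_map_iff_of_iso F a b h).1 h'), fun W u hu => ?_,
    fun u hu => ?_⟩
  · obtain ⟨s, hs⟩ := hf.2.1 (F.obj W) (F.map u ≫ b.hom) fun h' =>
      hu ((isSplitEpi_map_iff_of_iso F (Iso.refl _) b (by simp)).2 h')
    refine ⟨F.preimage (s ≫ a.inv), F.map_injective ?_⟩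
    rw [F.map_comp, F.map_preimage, ← cancel_mono b.hom]
    simp [h, hs]
  · have := hf.2.2 (a.inv ≫ F.map u ≫ a.hom) (by
      rw [Category.assoc, Category.assoc, ← h, ← F.map_comp_assoc, hu, h, a.inv_hom_id_assoc])
    have h1 : F.map u = a.hom ≫ (a.inv ≫ F.map u ≫ a.hom) ≫ a.inv := by simp
    have : IsIso (F.map u) := by rw [h1]; infer_instance
    exact isIso_of_reflects_iso u F

/-- Every morphism `W ⟶ F Y` factors through an object `F V`, in such a way that the second factor
is not a retraction unless the given morphism is one. -/
def FactorsThroughImage (F : C ⥤ D) (Y : C) : Prop :=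
  ∀ (W : D) (h : W ⟶ F.obj Y), ∃ (V : C) (π : W ⟶ F.obj V) (k : F.obj V ⟶ F.obj Y),
    π ≫ k = h ∧ (IsSplitEpi k → IsSplitEpi h)

/-- In a factorization `F f = g ≫ h`, the morphism `h` is replaced by its factor `k` in the image of
`F`, so that the irreducibility of `f` applies. -/
lemma IsIrreducible.map (hF : FactorsThroughImage F Y) (hf : IsIrreducible f) :
    IsIrreducible (F.map f) := by
  have e1 : ∀ {A B : C} (k : A ⟶ B), IsSplitMono k ↔ IsSplitMono (F.map k) := fun k =>
    isSplitMono_map_iff_of_iso F (Iso.refl _) (Iso.refl _) (by simp)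
  have e2 : ∀ {A B : C} (k : A ⟶ B), IsSplitEpi k ↔ IsSplitEpi (F.map k) := fun k =>
    isSplitEpi_map_iff_of_iso F (Iso.refl _) (Iso.refl _) (by simp)
  refine ⟨fun h' => hf.1 ((e1 f).2 h'), fun h' => hf.2.1 ((e2 f).2 h'), fun W g h hgh => ?_⟩
  obtain ⟨V, π, k, hk, hs⟩ := hF W h
  rcases hf.2.2 V (F.preimage (g ≫ π)) (F.preimage k)
    (F.map_injective (by simp [hk, hgh])) with h' | h'
  · left
    rw [e1, F.map_preimage] at h'
    obtain ⟨⟨r, hr⟩⟩ := h'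
    exact ⟨⟨⟨π ≫ r, by rw [← Category.assoc, hr]⟩⟩⟩
  · right
    rw [e2, F.map_preimage] at h'
    exact hs h'

lemma IsMinimalRightAlmostSplit.map (hF : FactorsThroughImage F Y)
    (hf : IsMinimalRightAlmostSplit f) : IsMinimalRightAlmostSplit (F.map f) := by
  have e2 : ∀ {A B : C} (k : A ⟶ B), IsSplitEpi k ↔ IsSplitEpi (F.map k) := fun k =>
    isSplitEpi_map_iff_of_iso F (Iso.refl _) (Iso.refl _) (by simp)
  refine ⟨fun h' => hf.1 ((e2 f).2 h'), fun W h hh => ?_, fun u hu => ?_⟩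
  · obtain ⟨V, π, k, hk, hs⟩ := hF W h
    obtain ⟨s, hs'⟩ := hf.2.1 V (F.preimage k) (fun h' => hh (hs (by
      rwa [e2, F.map_preimage] at h')))
    exact ⟨π ≫ F.map s, by rw [Category.assoc, ← F.map_comp, hs', F.map_preimage, hk]⟩
  · have := hf.2.2 (F.preimage u) (F.map_injective (by simp [hu]))
    rw [← F.map_preimage u]
    infer_instance

end Morphisms

/-! ### The inclusions and truncations -/

section Algebra

variable {Λ : Type u} [Ring Λ]

/-- Renumbering by `1` and then by `-1` is the identity. -/
def reindexUnit : reindex Λ 1 ⋙ reindex Λ (-1) ≅ 𝟭 (Cpx Λ) :=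
  NatIso.ofComponents (fun X => HomologicalComplex.Hom.isoOfComponents
    (fun i => X.XIsoOfEq (show i + -1 + 1 = i by omega))
    (fun i j _ => by
      change (X.XIsoOfEq _).hom ≫ X.d i j = X.d (i + -1 + 1) (j + -1 + 1) ≫ (X.XIsoOfEq _).hom
      simp)) (fun f => by
      ext i : 1
      exact HomologicalComplex.XIsoOfEq_hom_naturality f (show i + -1 + 1 = i by omega))

/-- Renumbering by `-1` and then by `1` is the identity. -/
def reindexCounit : reindex Λ (-1) ⋙ reindex Λ 1 ≅ 𝟭 (Cpx Λ) :=
  NatIso.ofComponents (fun X => HomologicalComplex.Hom.isoOfComponents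
    (fun i => X.XIsoOfEq (show i + 1 + -1 = i by omega))
    (fun i j _ => by
      change (X.XIsoOfEq _).hom ≫ X.d i j = X.d (i + 1 + -1) (j + 1 + -1) ≫ (X.XIsoOfEq _).hom
      simp)) (fun f => by
      ext i : 1
      exact HomologicalComplex.XIsoOfEq_hom_naturality f (show i + 1 + -1 = i by omega))

instance : (reindex Λ (-1)).IsEquivalence :=
  (CategoryTheory.Equivalence.mk (reindex Λ (-1)) (reindex Λ 1) reindexCounit.symm
    reindexUnit).isEquivalence_functor

/-- The left inclusion is induced by a renumbering. -/
def leftInclCompι (n : ℕ) :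
    leftIncl Λ n ⋙ (isSize Λ (n + 1)).ι ≅ (isSize Λ n).ι ⋙ reindex Λ (-1) := Iso.refl _

instance (n : ℕ) : (leftIncl Λ n).Full :=
  have : ((isSize Λ n).ι ⋙ reindex Λ (-1)).Full := Functor.Full.comp _ _
  Functor.Full.of_comp_faithful_iso (leftInclCompι n)

instance (n : ℕ) : (leftIncl Λ n).Faithful :=
  have : ((isSize Λ n).ι ⋙ reindex Λ (-1)).Faithful := Functor.Faithful.comp _ _
  Functor.Faithful.of_comp_iso (leftInclCompι n)

instance (n : ℕ) : (rightIncl Λ n).Full := (ObjectProperty.fullyFaithfulιOfLE _).full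
instance (n : ℕ) : (rightIncl Λ n).Faithful := (ObjectProperty.fullyFaithfulιOfLE _).faithful

open HomologicalComplex in
/-- The differentials of a brutal truncation are those of the complex. -/
lemma stupidTruncXIso_d {ι : Type*} {c : ComplexShape ι} (e : c.Embedding (ComplexShape.up ℤ))
    [e.IsRelIff] (X : Cpx Λ) {i j : ι} {i' j' : ℤ} (hi : e.f i = i') (hj : e.f j = j') :
    (X.stupidTrunc e).d i' j' ≫ (X.stupidTruncXIso e hj).hom =
      (X.stupidTruncXIso e hi).hom ≫ X.d i' j' := by
  subst hi hj
  have : (X.stupidTrunc e).d (e.f i) (e.f j) = _ := (X.restriction e).extend_d_eq e rfl rfl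
  rw [this]
  let A : (X.stupidTrunc e).X (e.f i) ≅ X.X (e.f i) := (X.restriction e).extendXIso e rfl
  let B : (X.stupidTrunc e).X (e.f j) ≅ X.X (e.f j) := (X.restriction e).extendXIso e rfl
  change (A.hom ≫ X.d (e.f i) (e.f j) ≫ B.inv) ≫ B.hom ≫ 𝟙 _ = (A.hom ≫ 𝟙 _) ≫ X.d (e.f i) (e.f j)
  simp

open scoped Classical in
/-- The inclusion of the brutal truncation in degrees at least `p`. -/
noncomputable def truncGEι (p : ℤ) (X : Cpx Λ) :
    X.stupidTrunc (ComplexShape.embeddingUpIntGE p) ⟶ X where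
  f j := if h : ∃ i, (ComplexShape.embeddingUpIntGE p).f i = j then
    (X.stupidTruncXIso _ h.choose_spec).hom else 0
  comm' i j hij := by
    by_cases hi : ∃ k, (ComplexShape.embeddingUpIntGE p).f k = i
    · have hj : ∃ k, (ComplexShape.embeddingUpIntGE p).f k = j := by
        obtain ⟨k, rfl⟩ := hi
        refine ⟨k + 1, ?_⟩
        simp only [ComplexShape.up_Rel] at hij
        simp [← hij]
        omega
      rw [dif_pos hi, dif_pos hj, stupidTruncXIso_d]
    · exact (X.isZero_stupidTrunc_X _ i (by simpa using hi)).eq_of_src _ _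

open scoped Classical in
/-- The projection onto the brutal truncation in degrees at most `p`. -/
noncomputable def truncLEπ (p : ℤ) (X : Cpx Λ) :
    X ⟶ X.stupidTrunc (ComplexShape.embeddingUpIntLE p) where
  f j := if h : ∃ i, (ComplexShape.embeddingUpIntLE p).f i = j then
    (X.stupidTruncXIso _ h.choose_spec).inv else 0
  comm' i j hij := by
    by_cases hj : ∃ k, (ComplexShape.embeddingUpIntLE p).f k = j
    · have hi : ∃ k, (ComplexShape.embeddingUpIntLE p).f k = i := by
        obtain ⟨k, rfl⟩ := hj
        refine ⟨k + 1, ?_⟩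
        simp only [ComplexShape.up_Rel] at hij
        simp at hij ⊢
        omega
      rw [dif_pos hi, dif_pos hj, Iso.inv_comp_eq, ← Category.assoc,
        ← stupidTruncXIso_d _ X hi.choose_spec hj.choose_spec,
        Category.assoc, Iso.hom_inv_id, Category.comp_id]
    · exact (X.isZero_stupidTrunc_X _ j (by simpa using hj)).eq_of_tgt _ _

lemma isIso_truncGEι_f (p : ℤ) (X : Cpx Λ) {j : ℤ} (hj : p ≤ j) : IsIso ((truncGEι p X).f j) := by
  have h : ∃ i, (ComplexShape.embeddingUpIntGE p).f i = j := ⟨(j - p).toNat, by simp; omega⟩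
  simp only [truncGEι, dif_pos h]
  infer_instance

lemma isIso_truncLEπ_f (p : ℤ) (X : Cpx Λ) {j : ℤ} (hj : j ≤ p) : IsIso ((truncLEπ p X).f j) := by
  have h : ∃ i, (ComplexShape.embeddingUpIntLE p).f i = j := ⟨(p - j).toNat, by simp; omega⟩
  simp only [truncLEπ, dif_pos h]
  infer_instance

lemma truncGE_isZero (p : ℤ) (X : Cpx Λ) {j : ℤ} (hj : j < p) :
    IsZero ((X.stupidTrunc (ComplexShape.embeddingUpIntGE p)).X j) :=
  X.isZero_stupidTrunc_X _ j ((ComplexShape.notMem_range_embeddingUpIntGE_iff p j).2 hj)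

lemma truncLE_isZero (p : ℤ) (X : Cpx Λ) {j : ℤ} (hj : p < j) :
    IsZero ((X.stupidTrunc (ComplexShape.embeddingUpIntLE p)).X j) :=
  X.isZero_stupidTrunc_X _ j ((ComplexShape.notMem_range_embeddingUpIntLE_iff p j).2 hj)

lemma truncGEι_naturality (p : ℤ) {X Y : Cpx Λ} (f : X ⟶ Y) :
    HomologicalComplex.stupidTruncMap f (ComplexShape.embeddingUpIntGE p) ≫ truncGEι p Y =
      truncGEι p X ≫ f := by
  ext j : 1
  by_cases h : ∃ i, (ComplexShape.embeddingUpIntGE p).f i = j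
  · simp only [HomologicalComplex.comp_f, truncGEι, dif_pos h]
    exact HomologicalComplex.stupidTruncMap_stupidTruncXIso_hom _ _ _
  · exact (X.isZero_stupidTrunc_X _ j (by simpa using h)).eq_of_src _ _

lemma truncLEπ_naturality (p : ℤ) {X Y : Cpx Λ} (f : X ⟶ Y) :
    truncLEπ p X ≫ HomologicalComplex.stupidTruncMap f (ComplexShape.embeddingUpIntLE p) =
      f ≫ truncLEπ p Y := by
  ext j : 1
  by_cases h : ∃ i, (ComplexShape.embeddingUpIntLE p).f i = j
  · simp only [HomologicalComplex.comp_f, truncLEπ, dif_pos h]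
    rw [Iso.inv_comp_eq, ← Category.assoc, ← HomologicalComplex.stupidTruncMap_stupidTruncXIso_hom,
      Category.assoc, Iso.hom_inv_id, Category.comp_id]
  · exact (Y.isZero_stupidTrunc_X _ j (by simpa using h)).eq_of_tgt _ _

lemma isIso_truncGEι (p : ℤ) {X : Cpx Λ} (hX : ∀ j, j < p → IsZero (X.X j)) :
    IsIso (truncGEι p X) := by
  have : ∀ j, IsIso ((truncGEι p X).f j) := fun j => by
    by_cases h : p ≤ j
    · exact isIso_truncGEι_f p X h
    · exact ⟨0, (truncGE_isZero p X (by omega)).eq_of_src _ _,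
        (hX j (by omega)).eq_of_src _ _⟩
  exact HomologicalComplex.Hom.isIso_of_components _

/-- A morphism from a complex supported in degrees at least `p` lifts to the truncation. -/
lemma exists_lift_truncGE (p : ℤ) {X Y : Cpx Λ} (f : X ⟶ Y) (hX : ∀ j, j < p → IsZero (X.X j)) :
    ∃ f' : X ⟶ Y.stupidTrunc (ComplexShape.embeddingUpIntGE p), f' ≫ truncGEι p Y = f := by
  have := isIso_truncGEι p hX
  refine ⟨inv (truncGEι p X) ≫ HomologicalComplex.stupidTruncMap f _, ?_⟩
  rw [Category.assoc, truncGEι_naturality, IsIso.inv_hom_id_assoc]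

lemma isIso_truncLEπ (p : ℤ) {Y : Cpx Λ} (hY : ∀ j, p < j → IsZero (Y.X j)) :
    IsIso (truncLEπ p Y) := by
  have : ∀ j, IsIso ((truncLEπ p Y).f j) := fun j => by
    by_cases h : j ≤ p
    · exact isIso_truncLEπ_f p Y h
    · exact ⟨0, (hY j (by omega)).eq_of_src _ _,
        (truncLE_isZero p Y (by omega)).eq_of_src _ _⟩
  exact HomologicalComplex.Hom.isIso_of_components _

/-- A morphism to a complex supported in degrees at most `p` descends to the truncation. -/
lemma exists_desc_truncLE (p : ℤ) {X Y : Cpx Λ} (f : X ⟶ Y) (hY : ∀ j, p < j → IsZero (Y.X j)) :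
    ∃ f' : X.stupidTrunc (ComplexShape.embeddingUpIntLE p) ⟶ Y, truncLEπ p X ≫ f' = f := by
  have := isIso_truncLEπ p hY
  refine ⟨HomologicalComplex.stupidTruncMap f _ ≫ inv (truncLEπ p Y), ?_⟩
  rw [← Category.assoc, truncLEπ_naturality, Category.assoc, IsIso.hom_inv_id, Category.comp_id]

/-- A morphism to the truncation in degrees at most `p` lifts to the whole complex if the source
vanishes in degrees at least `p`. -/
lemma exists_lift_truncLE (p : ℤ) {X Y : Cpx Λ}
    (f : Y ⟶ X.stupidTrunc (ComplexShape.embeddingUpIntLE p)) (hY : ∀ j, p ≤ j → IsZero (Y.X j)) :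
    ∃ f' : Y ⟶ X, f' ≫ truncLEπ p X = f := by
  have hiso : ∀ j, j ≤ p → IsIso ((truncLEπ p X).f j) := fun j hj => isIso_truncLEπ_f p X hj
  have hex : ∀ j, ∃ g : Y.X j ⟶ X.X j, g ≫ (truncLEπ p X).f j = f.f j := fun j => by
    by_cases hj : j ≤ p
    · have := hiso j hj
      exact ⟨f.f j ≫ inv ((truncLEπ p X).f j), by simp⟩
    · exact ⟨0, (hY j (by omega)).eq_of_src _ _⟩
  choose g hg using hex
  refine ⟨{ f := g, comm' := fun i j hij => ?_ }, by ext j : 1; exact hg j⟩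
  by_cases hj : j ≤ p
  · have := hiso j hj
    rw [← cancel_mono ((truncLEπ p X).f j), Category.assoc, Category.assoc, hg, ← f.comm, ← hg i,
      Category.assoc, (truncLEπ p X).comm]
  · exact (hY i (by simp only [ComplexShape.up_Rel] at hij; omega)).eq_of_src _ _

end Algebra

/-! ### Degreewise split sequences -/

section DegSplit

variable {𝒜 : Type*} [Category* 𝒜] [Preadditive 𝒜]

/-- The sequence `A ⟶ B ⟶ C` of complexes is split exact in each degree. -/
def IsDegSplit {A B C : CochainComplex 𝒜 ℤ} (f : A ⟶ B) (g : B ⟶ C) : Prop :=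
  ∀ j, ∃ (r : B.X j ⟶ A.X j) (s : C.X j ⟶ B.X j),
    f.f j ≫ r = 𝟙 _ ∧ s ≫ g.f j = 𝟙 _ ∧ r ≫ f.f j + g.f j ≫ s = 𝟙 _

namespace IsDegSplit

variable {A B C : CochainComplex 𝒜 ℤ} {f : A ⟶ B} {g : B ⟶ C}

lemma comp_eq_zero (h : IsDegSplit f g) : f ≫ g = 0 := by
  ext j : 1
  obtain ⟨r, s, h1, h2, h3⟩ := h j
  have := congrArg (fun x => f.f j ≫ x ≫ g.f j) h3
  simp only [Preadditive.add_comp, Preadditive.comp_add, Category.assoc, reassoc_of% h1, h2,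
    Category.comp_id, Category.id_comp] at this
  simpa using this

lemma mono (h : IsDegSplit f g) (j : ℤ) : Mono (f.f j) := by
  obtain ⟨r, s, h1, h2, h3⟩ := h j
  exact mono_of_mono_fac h1

lemma epi (h : IsDegSplit f g) (j : ℤ) : Epi (g.f j) := by
  obtain ⟨r, s, h1, h2, h3⟩ := h j
  exact epi_of_epi_fac h2

/-- The first morphism of a degreewise split sequence is a kernel of the second one. -/
lemma exists_lift (h : IsDegSplit f g) {V : CochainComplex 𝒜 ℤ} (v : V ⟶ B) (hv : v ≫ g = 0) :
    ∃ c : V ⟶ A, c ≫ f = v := by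
  have hf := h.mono
  choose r s h1 h2 h3 using h
  have hc : ∀ j, (v.f j ≫ r j) ≫ f.f j = v.f j := fun j => by
    have hvj : v.f j ≫ g.f j = 0 := by rw [← HomologicalComplex.comp_f, hv]; rfl
    rw [Category.assoc, eq_sub_of_add_eq (h3 j), Preadditive.comp_sub, Category.comp_id,
      reassoc_of% hvj, zero_comp, sub_zero]
  refine ⟨{ f := fun j => v.f j ≫ r j, comm' := fun i j _ => ?_ }, by ext j : 1; exact hc j⟩
  rw [← cancel_mono (f.f j), Category.assoc, ← f.comm, ← Category.assoc, hc, Category.assoc, hc,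
    v.comm]

/-- The second morphism of a degreewise split sequence is a cokernel of the first one. -/
lemma exists_desc (h : IsDegSplit f g) {V : CochainComplex 𝒜 ℤ} (v : B ⟶ V) (hv : f ≫ v = 0) :
    ∃ c : C ⟶ V, g ≫ c = v := by
  have hg := h.epi
  choose r s h1 h2 h3 using h
  have hc : ∀ j, g.f j ≫ (s j ≫ v.f j) = v.f j := fun j => by
    have hvj : f.f j ≫ v.f j = 0 := by rw [← HomologicalComplex.comp_f, hv]; rfl
    rw [← Category.assoc, eq_sub_of_add_eq' (h3 j), Preadditive.sub_comp, Category.id_comp,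
      Category.assoc, hvj, comp_zero, sub_zero]
  refine ⟨{ f := fun j => s j ≫ v.f j, comm' := fun i j _ => ?_ }, by ext j : 1; exact hc j⟩
  rw [← cancel_epi (g.f i), Category.assoc, reassoc_of% hc, g.comm_assoc, hc, v.comm]

lemma cancel_mono (h : IsDegSplit f g) {V : CochainComplex 𝒜 ℤ} {v w : V ⟶ A}
    (hvw : v ≫ f = w ≫ f) : v = w := by
  ext j : 1
  have := h.mono j
  rw [← CategoryTheory.cancel_mono (f.f j)]
  exact congrArg (fun x => HomologicalComplex.Hom.f x j) hvw

lemma cancel_epi (h : IsDegSplit f g) {V : CochainComplex 𝒜 ℤ} {v w : C ⟶ V}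
    (hvw : g ≫ v = g ≫ w) : v = w := by
  ext j : 1
  have := h.epi j
  rw [← CategoryTheory.cancel_epi (g.f j)]
  exact congrArg (fun x => HomologicalComplex.Hom.f x j) hvw

/-- The pushout of a degreewise split sequence along a morphism from its first term. Its cells are
`U.X j ⊞ C.X j`, and the connecting part of the differential is the cocycle `s ≫ d ≫ r` of the given
sequence, followed by `u`. -/
lemma exists_pushout [HasBinaryBiproducts 𝒜] (h : IsDegSplit f g) {U : CochainComplex 𝒜 ℤ}
    (u : A ⟶ U) : ∃ (P : CochainComplex 𝒜 ℤ) (l : U ⟶ P) (q : P ⟶ C) (k : B ⟶ P),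
      IsDegSplit l q ∧ f ≫ k = u ≫ l ∧ k ≫ q = g ∧
        ∀ j, IsZero (U.X j) → IsZero (C.X j) → IsZero (P.X j) := by
  have hfg := h.comp_eq_zero
  have hf := h.mono
  choose r s h1 h2 h3 using h
  have hrf : ∀ j, r j ≫ f.f j = 𝟙 _ - g.f j ≫ s j := fun j => eq_sub_of_add_eq (h3 j)
  have hθ : ∀ i j k, (s i ≫ B.d i j ≫ r j) ≫ A.d j k + C.d i j ≫ s j ≫ B.d j k ≫ r k = 0 := by
    intro i j k
    rw [← CategoryTheory.cancel_mono (f.f k)]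
    simp only [Preadditive.add_comp, Category.assoc, ← f.comm]
    rw [hrf k, reassoc_of% (hrf j)]
    simp only [Preadditive.comp_sub, Preadditive.sub_comp, Category.comp_id, Category.assoc,
      Category.id_comp, HomologicalComplex.d_comp_d, comp_zero, zero_comp]
    simp only [← g.comm_assoc, reassoc_of% h2, HomologicalComplex.d_comp_d_assoc, zero_comp]
    simp
  have hr : ∀ i j, r i ≫ A.d i j + g.f i ≫ s i ≫ B.d i j ≫ r j = B.d i j ≫ r j := by
    intro i j
    have : A.d i j = f.f i ≫ B.d i j ≫ r j := by rw [f.comm_assoc, h1, Category.comp_id]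
    rw [this, reassoc_of% (hrf i)]
    simp
  let P : CochainComplex 𝒜 ℤ :=
    { X := fun j => U.X j ⊞ C.X j
      d := fun i j => biprod.desc (biprod.lift (U.d i j) 0)
        (biprod.lift ((s i ≫ B.d i j ≫ r j) ≫ u.f j) (C.d i j))
      shape := fun i j hij => by
        rw [U.shape i j hij, B.shape i j hij, C.shape i j hij]
        ext <;> simp
      d_comp_d' := fun i j k _ _ => by
        have := hθ i j k =≫ u.f k
        simp only [Preadditive.add_comp, Category.assoc, zero_comp] at this
        ext <;> simp [this] }
  let l : U ⟶ P :=
    { f := fun j => biprod.inl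
      comm' := fun i j _ => by
        change biprod.inl ≫ biprod.desc _ _ = _
        ext <;> simp }
  let q : P ⟶ C :=
    { f := fun j => biprod.snd
      comm' := fun i j _ => by
        change biprod.snd ≫ _ = biprod.desc _ _ ≫ biprod.snd
        ext <;> simp }
  let k : B ⟶ P :=
    { f := fun j => biprod.lift (r j ≫ u.f j) (g.f j)
      comm' := fun i j _ => by
        have := hr i j =≫ u.f j
        simp only [Preadditive.add_comp, Category.assoc] at this
        change biprod.lift _ _ ≫ biprod.desc _ _ = _
        ext <;> simp [this] }
  refine ⟨P, l, q, k, fun j => ⟨biprod.fst, biprod.inr, ?_, ?_, ?_⟩, ?_, ?_, fun j hU hC => ?_⟩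
  · exact biprod.inl_fst
  · exact biprod.inr_snd
  · exact biprod.total
  · ext j : 1
    change f.f j ≫ biprod.lift _ _ = u.f j ≫ biprod.inl
    have h4 : f.f j ≫ g.f j = 0 := by rw [← HomologicalComplex.comp_f, hfg]; rfl
    ext
    · simp [reassoc_of% (h1 j)]
    · simp [h4]
  · ext j : 1
    exact biprod.lift_snd _ _
  · exact (biprod_isZero_iff _ _).2 ⟨hU, hC⟩

/-- A morphism `u` from the first term of a nonsplit degreewise split sequence extends to the middle
term as soon as the epimorphism `q` of the pushout sequence along `u` is a retraction or factors
through `g`: in the second case, the induced endomorphism of the first term is nilpotent if `u` is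
not a section, and its powers would split the sequence. -/
lemma exists_extension [HasBinaryBiproducts 𝒜] (h : IsDegSplit f g) (hA : IsFitting A)
    (hg : ¬ IsSplitEpi g) {U : CochainComplex 𝒜 ℤ} (u : A ⟶ U) (hu : ¬ IsSplitMono u) :
    ∃ (P : CochainComplex 𝒜 ℤ) (q : P ⟶ C),
      (∀ j, IsZero (U.X j) → IsZero (C.X j) → IsZero (P.X j)) ∧
      ((IsSplitEpi q ∨ ∃ t : P ⟶ B, t ≫ g = q) → ∃ e : B ⟶ U, f ≫ e = u) := by
  obtain ⟨P, l, q, k, hlq, hk, hkq, hz⟩ := h.exists_pushout u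
  refine ⟨P, q, hz, ?_⟩
  rintro (⟨⟨s, hs⟩⟩ | ⟨t, ht⟩)
  · obtain ⟨e, he⟩ := hlq.exists_lift (k - g ≫ s) (by
      rw [Preadditive.sub_comp, hkq, Category.assoc, hs, Category.comp_id, sub_self])
    refine ⟨e, hlq.cancel_mono ?_⟩
    rw [Category.assoc, he, Preadditive.comp_sub, hk, reassoc_of% h.comp_eq_zero, zero_comp,
      sub_zero]
  · exfalso
    obtain ⟨c, hc⟩ := h.exists_lift (l ≫ t) (by rw [Category.assoc, ht, hlq.comp_eq_zero])
    rcases hA (u ≫ c) with hiso | ⟨n, hn⟩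
    · exact hu ⟨⟨⟨c ≫ inv (u ≫ c), by rw [← Category.assoc, IsIso.hom_inv_id]⟩⟩⟩
    · have hpow : ∀ m : ℕ, f ≫ (End.of (k ≫ t) ^ m).asHom = (End.of (u ≫ c) ^ m).asHom ≫ f ∧
          (End.of (k ≫ t) ^ m).asHom ≫ g = g := by
        intro m
        induction m with
        | zero => exact ⟨(Category.comp_id f).trans (Category.id_comp f).symm, Category.id_comp g⟩
        | succ m ih =>
          rw [pow_succ, pow_succ]
          change f ≫ (k ≫ t) ≫ (End.of (k ≫ t) ^ m).asHom =
            ((u ≫ c) ≫ (End.of (u ≫ c) ^ m).asHom) ≫ f ∧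
            ((k ≫ t) ≫ (End.of (k ≫ t) ^ m).asHom) ≫ g = g
          constructor
          · simp only [Category.assoc]
            rw [reassoc_of% hk, ← ih.1, reassoc_of% hc]
          · rw [Category.assoc, ih.2, Category.assoc, ht, hkq]
      obtain ⟨hp1, hp2⟩ := hpow n
      rw [hn, zero_comp] at hp1
      obtain ⟨s, hs⟩ := h.exists_desc _ hp1
      exact hg ⟨⟨⟨s, h.cancel_epi (by rw [reassoc_of% hs, hp2, Category.comp_id])⟩⟩⟩

lemma isZero_middle (h : IsDegSplit f g) {j : ℤ} (hA : IsZero (A.X j)) (hC : IsZero (C.X j)) :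
    IsZero (B.X j) := by
  obtain ⟨r, s, h1, h2, h3⟩ := h j
  rw [IsZero.iff_id_eq_zero, ← h3, hA.eq_of_src (f.f j) 0, hC.eq_of_src s 0, comp_zero, comp_zero,
    add_zero]

lemma isZero_right (h : IsDegSplit f g) {j : ℤ} (hB : IsZero (B.X j)) : IsZero (C.X j) := by
  obtain ⟨r, s, h1, h2, h3⟩ := h j
  rw [IsZero.iff_id_eq_zero, ← h2, hB.eq_of_src (g.f j) 0, comp_zero]

lemma of_iso (h : IsDegSplit f g) {A' B' C' : CochainComplex 𝒜 ℤ} {f' : A' ⟶ B'}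
    {g' : B' ⟶ C'} (a : A' ≅ A) (b : B' ≅ B) (c : C' ≅ C)
    (hf : f' ≫ b.hom = a.hom ≫ f) (hg : g' ≫ c.hom = b.hom ≫ g) :
    IsDegSplit f' g' := by
  intro j
  obtain ⟨r, s, h1, h2, h3⟩ := h j
  have hf' : f'.f j ≫ b.hom.f j = a.hom.f j ≫ f.f j :=
    congrArg (fun x => HomologicalComplex.Hom.f x j) hf
  have hg' : g'.f j ≫ c.hom.f j = b.hom.f j ≫ g.f j :=
    congrArg (fun x => HomologicalComplex.Hom.f x j) hg
  have hf'' : a.inv.f j ≫ f'.f j = f.f j ≫ b.inv.f j := by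
    have h5 : a.inv ≫ f' = f ≫ b.inv := by
      rw [a.inv_comp_eq, ← Category.assoc, b.eq_comp_inv, hf]
    exact congrArg (fun x => HomologicalComplex.Hom.f x j) h5
  have hg'' : b.inv.f j ≫ g'.f j = g.f j ≫ c.inv.f j := by
    have h5 : b.inv ≫ g' = g ≫ c.inv := by
      rw [b.inv_comp_eq, ← Category.assoc, c.eq_comp_inv, hg]
    exact congrArg (fun x => HomologicalComplex.Hom.f x j) h5
  refine ⟨b.hom.f j ≫ r ≫ a.inv.f j, c.hom.f j ≫ s ≫ b.inv.f j, ?_, ?_, ?_⟩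
  · rw [reassoc_of% hf', reassoc_of% h1, ← HomologicalComplex.comp_f, a.hom_inv_id]
    rfl
  · simp only [Category.assoc]
    rw [hg'', reassoc_of% h2, ← HomologicalComplex.comp_f, c.hom_inv_id]
    rfl
  · simp only [Category.assoc]
    rw [hf'', reassoc_of% hg']
    have : b.hom.f j ≫ (r ≫ f.f j + g.f j ≫ s) ≫ b.inv.f j = 𝟙 _ := by
      rw [h3, Category.id_comp, ← HomologicalComplex.comp_f, b.hom_inv_id]
      rfl
    simpa only [Preadditive.add_comp, Preadditive.comp_add, Category.assoc] using this

end IsDegSplit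

end DegSplit

section Algebra

variable {Λ : Type u} [Ring Λ]

lemma isConflation_iff {n : ℕ} {X Y Z : CSize Λ n} (f : X ⟶ Y) (g : Y ⟶ Z) :
    IsConflation f g ↔ IsDegSplit f.hom g.hom := by
  constructor
  · rintro ⟨w, h⟩ j
    by_cases hj : j ∈ Set.Icc (1 : ℤ) n
    · obtain ⟨σ⟩ := h j hj
      exact ⟨σ.r, σ.s, σ.f_r, σ.s_g, σ.id⟩
    · exact ⟨0, 0, (X.property j hj).eq_of_src _ _, (Z.property j hj).eq_of_src _ _,
        (Y.property j hj).eq_of_src _ _⟩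
  · intro h
    refine ⟨ObjectProperty.hom_ext _ h.comp_eq_zero, fun j _ => ?_⟩
    obtain ⟨r, s, h1, h2, h3⟩ := h j
    exact ⟨{ r := r, s := s, f_r := h1, s_g := h2, id := h3 }⟩

/-! ### Fitting objects in full subcategories -/

lemma IsFitting.of_fullyFaithful {C D : Type*} [Category* C] [Category* D] [HasZeroMorphisms C]
    [HasZeroMorphisms D] (F : C ⥤ D) [F.Full] [F.Faithful] [F.PreservesZeroMorphisms] (X : C) :
    IsFitting (F.obj X) ↔ IsFitting X := by
  have hpow : ∀ (φ : X ⟶ X) (n : ℕ),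
      F.map (End.of φ ^ n).asHom = (End.of (F.map φ) ^ n).asHom := by
    intro φ n
    induction n with
    | zero => exact F.map_id X
    | succ n ih =>
      rw [pow_succ, pow_succ]
      change F.map (φ ≫ (End.of φ ^ n).asHom) = F.map φ ≫ (End.of (F.map φ) ^ n).asHom
      rw [F.map_comp, ih]
  have key : ∀ φ : X ⟶ X, (IsIso (F.map φ) ∨ ∃ n : ℕ, (End.of (F.map φ) ^ n).asHom = 0) ↔
      (IsIso φ ∨ ∃ n : ℕ, (End.of φ ^ n).asHom = 0) := by
    intro φ
    refine or_congr (isIso_iff_of_reflects_iso φ F) (exists_congr fun n => ?_)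
    rw [← hpow]
    exact F.map_eq_zero_iff
  constructor
  · exact fun h φ => (key φ).1 (h _)
  · intro h φ
    rw [← F.map_preimage φ]
    exact (key _).2 (h _)

lemma IsFitting.isIso_of_add_eq_id {C : Type*} [Category* C] [Preadditive C] {X : C}
    (hX : IsFitting X) {α β : X ⟶ X} (h : α + β = 𝟙 X) (hα : ¬ IsIso α) : IsIso β := by
  obtain ⟨n, hn⟩ := (hX α).resolve_left hα
  have h1 : IsNilpotent (End.of α) := ⟨n, hn⟩
  have h2 : IsUnit (1 - End.of α) := h1.isUnit_one_sub
  have h3 : β = (1 - End.of α).asHom := eq_sub_of_add_eq' h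
  rw [h3]
  exact (isUnit_iff_isIso _).1 h2

lemma indecomposable_obj {n : ℕ} {X : CSize Λ n} (hX : Indecomposable X) :
    Indecomposable X.obj := by
  refine ⟨fun h => hX.1 ?_, fun Y Z e => ?_⟩
  · rw [IsZero.iff_id_eq_zero]
    exact ObjectProperty.hom_ext _ (h.eq_of_src _ _)
  · have hs : IsSupp X.obj 1 n := X.property
    have r1 : (biprod.inl ≫ e.inv) ≫ (e.hom ≫ biprod.fst) = 𝟙 Y := by simp
    have r2 : (biprod.inr ≫ e.inv) ≫ (e.hom ≫ biprod.snd) = 𝟙 Z := by simp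
    let Y' : CSize Λ n := ⟨Y, hs.of_retract _ _ r1⟩
    let Z' : CSize Λ n := ⟨Z, hs.of_retract _ _ r2⟩
    have htot : (e.hom ≫ biprod.fst) ≫ (biprod.inl ≫ e.inv) +
        (e.hom ≫ biprod.snd) ≫ (biprod.inr ≫ e.inv) = 𝟙 X.obj := by
      calc _ = e.hom ≫ (biprod.fst ≫ biprod.inl + biprod.snd ≫ biprod.inr) ≫ e.inv := by
            simp only [Preadditive.add_comp, Preadditive.comp_add, Category.assoc]
        _ = 𝟙 X.obj := by rw [biprod.total, Category.id_comp, e.hom_inv_id]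
    refine (hX.2 Y' Z' (isoBiprodOfRetracts (Y := Y') (Z := Z')
      (i := ObjectProperty.homMk (biprod.inl ≫ e.inv))
      (r := ObjectProperty.homMk (e.hom ≫ biprod.fst))
      (s := ObjectProperty.homMk (biprod.inr ≫ e.inv))
      (q := ObjectProperty.homMk (e.hom ≫ biprod.snd)) (ObjectProperty.hom_ext _ r1)
      (ObjectProperty.hom_ext _ r2) (ObjectProperty.hom_ext _ htot))).imp ?_ ?_
    · exact fun h => (isSize Λ n).ι.map_isZero h
    · exact fun h => (isSize Λ n).ι.map_isZero h

lemma isFitting_of_indecomposable_cSize [IsArtinianRing Λᵐᵒᵖ] {n : ℕ} {X : CSize Λ n}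
    (hX : Indecomposable X) : IsFitting X :=
  (IsFitting.of_fullyFaithful (isSize Λ n).ι X).1
    (isFitting_of_indecomposable X.property (indecomposable_obj hX))

end Algebra

/-! ### Comparison of an object with its truncations -/

section Algebra

variable {Λ : Type u} [Ring Λ]

/-- The natural morphism from `0 → X^2 → ⋯ → X^{n+1}` to `X`. -/
noncomputable def leftComparison {n : ℕ} (X : CSize Λ (n + 1)) :
    (leftIncl Λ n).obj ((leftTrunc Λ n).obj X) ⟶ X :=
  ObjectProperty.homMk ((reindex Λ (-1)).map ((reindex Λ 1).map (truncGEι 2 X.obj)) ≫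
    reindexUnit.hom.app X.obj)

lemma leftComparison_naturality {n : ℕ} {X Y : CSize Λ (n + 1)} (f : X ⟶ Y) :
    (leftIncl Λ n).map ((leftTrunc Λ n).map f) ≫ leftComparison Y = leftComparison X ≫ f := by
  apply ObjectProperty.hom_ext
  change (reindex Λ (-1)).map ((reindex Λ 1).map
      (HomologicalComplex.stupidTruncMap f.hom (ComplexShape.embeddingUpIntGE 2))) ≫
      (reindex Λ (-1)).map ((reindex Λ 1).map (truncGEι 2 Y.obj)) ≫ reindexUnit.hom.app Y.obj =
    ((reindex Λ (-1)).map ((reindex Λ 1).map (truncGEι 2 X.obj)) ≫ reindexUnit.hom.app X.obj) ≫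
      f.hom
  have h := reindexUnit.hom.naturality f.hom
  dsimp at h
  rw [Category.assoc, ← h, ← Category.assoc, ← Category.assoc, ← Functor.map_comp,
    ← Functor.map_comp, ← Functor.map_comp, ← Functor.map_comp, truncGEι_naturality]

lemma isIso_leftComparison {n : ℕ} {X : CSize Λ (n + 1)} (h : IsZero (X.obj.X 1)) :
    IsIso (leftComparison X) := by
  have : IsIso (truncGEι 2 X.obj) := by
    refine isIso_truncGEι 2 fun j hj => ?_
    by_cases h1 : j = 1
    · exact h1 ▸ h
    · exact X.property j fun h' => by have := h'.1; omega
  rw [← ObjectProperty.isIso_hom_iff]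
  have h1 : IsIso ((reindex Λ (-1)).map ((reindex Λ 1).map (truncGEι 2 X.obj))) :=
    Functor.map_isIso _ _
  exact (asIso ((reindex Λ (-1)).map ((reindex Λ 1).map (truncGEι 2 X.obj))) ≪≫
    reindexUnit.app X.obj).isIso_hom

/-- The natural morphism from `X` to `X^1 → ⋯ → X^n → 0`. -/
noncomputable def rightComparison {n : ℕ} (X : CSize Λ (n + 1)) :
    X ⟶ (rightIncl Λ n).obj ((rightTrunc Λ n).obj X) :=
  ObjectProperty.homMk (truncLEπ n X.obj)

lemma rightComparison_naturality {n : ℕ} {X Y : CSize Λ (n + 1)} (f : X ⟶ Y) :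
    rightComparison X ≫ (rightIncl Λ n).map ((rightTrunc Λ n).map f) = f ≫ rightComparison Y :=
  ObjectProperty.hom_ext _ (truncLEπ_naturality n f.hom)

lemma isIso_rightComparison {n : ℕ} {X : CSize Λ (n + 1)} {i : ℤ} (hi : i = n + 1)
    (h : IsZero (X.obj.X i)) : IsIso (rightComparison X) := by
  subst hi
  have : IsIso (truncLEπ n X.obj) := by
    refine isIso_truncLEπ n fun j hj => ?_
    by_cases h1 : j = n + 1
    · exact h1 ▸ h
    · exact X.property j fun h' => by have := h'.2; push_cast at this; omega
  rw [← ObjectProperty.isIso_hom_iff]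
  exact this

/-! ### Factoring morphisms through the image of an inclusion -/

/-- The object `W` splits into `W₁`, which vanishes at the right end, and `W₂`, which vanishes at
the left end. The morphism on `W₁` factors through a complex `W'` which vanishes at both ends, so
`h` factors through `W' ⊞ W₂`, which vanishes at the left end. If `W' ⊞ W₂ ⟶ Y` is a retraction, then
the identity of `Y` is the sum of endomorphisms which factor through `W'` and `W₂`. The first one is
not invertible, since `W'` vanishes where the last cell of `Y` does not; so the second one is. -/
lemma factorsThroughImage_leftIncl [IsArtinianRing Λᵐᵒᵖ] {η : ℕ} (hη : 1 ≤ η)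
    (hΛ : strongGlobalDimension Λ = η) {Y : CSize Λ (η + 1)} (hY : Indecomposable Y)
    (hY0 : ¬ IsZero (Y.obj.X (η + 1))) : FactorsThroughImage (leftIncl Λ (η + 1)) Y := by
  intro W h
  have hfit : IsFitting ((leftIncl Λ (η + 1)).obj Y) :=
    (IsFitting.of_fullyFaithful (isSize Λ (η + 1 + 1)).ι _).1
      ((IsFitting.of_fullyFaithful (reindex Λ (-1)) Y.obj).2
        (isFitting_of_indecomposable Y.property (indecomposable_obj hY)))
  have hWs : IsSupp W.obj 1 (η + 2) := fun j hj => W.property j (by push_cast; exact hj)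
  have hYs : IsSupp ((leftIncl Λ (η + 1)).obj Y).obj (1 + 1) (η + 1 + 1) := fun j hj =>
    Y.property (j + -1) fun h' => hj ⟨by have := h'.1; omega, by
      have := h'.2
      push_cast at this
      omega⟩
  have hY0' : ¬ IsZero (((leftIncl Λ (η + 1)).obj Y).obj.X (η + 2)) := by
    change ¬ IsZero (Y.obj.X (η + 2 + -1))
    rwa [show (η + 2 + -1 : ℤ) = η + 1 by omega]
  obtain ⟨W₁, W₂, i₁, p₁, i₂, p₂, hW₁, hW₂, e1, e2, e3⟩ := exists_splitting hη hΛ hWs (by omega)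
  obtain ⟨W', x, y, hW', hxy⟩ := exists_factorization hη hΛ (i₁ ≫ h.hom) (a := 1) (b := η + 1)
    (hW₁.mono (by omega) (by omega)) hYs (by omega)
  have hV : IsSupp (W' ⊞ W₂) (1 + 1) (η + 2) := (hW'.mono (by omega) (by omega)).biprod hW₂
  let V : CSize Λ (η + 1 + 1) := ⟨W' ⊞ W₂, fun j hj => hV j fun h' => hj
    ⟨by have := h'.1; omega, by have := h'.2; push_cast; omega⟩⟩
  have := isIso_leftComparison (X := V) (hV 1 fun h' => by have := h'.1; omega)
  let π : W ⟶ V := ObjectProperty.homMk (biprod.lift (p₁ ≫ x) p₂)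
  let k : V ⟶ (leftIncl Λ (η + 1)).obj Y := ObjectProperty.homMk (biprod.desc y (i₂ ≫ h.hom))
  refine ⟨(leftTrunc Λ (η + 1)).obj V, π ≫ inv (leftComparison V), leftComparison V ≫ k, ?_, ?_⟩
  · rw [Category.assoc, IsIso.inv_hom_id_assoc]
    apply ObjectProperty.hom_ext
    change biprod.lift (p₁ ≫ x) p₂ ≫ biprod.desc y (i₂ ≫ h.hom) = h.hom
    rw [biprod.lift_desc, Category.assoc, hxy, ← Category.assoc, ← Category.assoc,
      ← Preadditive.add_comp, e3, Category.id_comp]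
  · rintro ⟨⟨s, hs⟩⟩
    let t := s ≫ leftComparison V
    have ht : t ≫ k = 𝟙 _ := by rw [Category.assoc, hs]
    have ht' : t.hom ≫ biprod.desc y (i₂ ≫ h.hom) = 𝟙 _ := congrArg (fun z => z.hom) ht
    have hsum : (t.hom ≫ biprod.fst) ≫ y + (t.hom ≫ biprod.snd ≫ i₂) ≫ h.hom = 𝟙 _ := by
      rw [← ht', biprod.desc_eq, Preadditive.comp_add]
      simp only [Category.assoc]
    let α : (leftIncl Λ (η + 1)).obj Y ⟶ (leftIncl Λ (η + 1)).obj Y :=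
      ObjectProperty.homMk ((t.hom ≫ biprod.fst) ≫ y)
    let σ : (leftIncl Λ (η + 1)).obj Y ⟶ W := ObjectProperty.homMk (t.hom ≫ biprod.snd ≫ i₂)
    have hαβ : α + σ ≫ h = 𝟙 _ := ObjectProperty.hom_ext _ hsum
    have hα : ¬ IsIso α := fun hα => by
      have hα' : IsIso ((t.hom ≫ biprod.fst) ≫ y) := (ObjectProperty.isIso_hom_iff α).2 hα
      refine hY0' (isZero_X_of_retract (t.hom ≫ biprod.fst)
        (y ≫ inv ((t.hom ≫ biprod.fst) ≫ y)) ?_ (hW' _ fun h' => by have := h'.2; omega))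
      rw [← Category.assoc, IsIso.hom_inv_id]
    have := hfit.isIso_of_add_eq_id hαβ hα
    exact ⟨⟨⟨inv (σ ≫ h) ≫ σ, by rw [Category.assoc, IsIso.inv_hom_id]⟩⟩⟩

/-- A morphism `h : W ⟶ Y` to a complex whose last cell vanishes factors through the truncation of
`W`, and it is a retraction if the factor is one: a section from `Y` to the truncation lifts to `W`,
as the differential into the removed cell of `W` starts at the cell where `Y` vanishes. -/
lemma factorsThroughImage_rightIncl {n : ℕ} {Y : CSize Λ n} (hY0 : IsZero (Y.obj.X n)) :
    FactorsThroughImage (rightIncl Λ n) Y := by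
  intro W h
  have hYs : ∀ j, (n : ℤ) ≤ j → IsZero (((rightIncl Λ n).obj Y).obj.X j) := fun j hj => by
    by_cases h1 : j = n
    · exact h1 ▸ hY0
    · exact Y.property j fun h' => by have := h'.2; omega
  obtain ⟨k, hk⟩ := exists_desc_truncLE n h.hom fun j hj => hYs j hj.le
  refine ⟨(rightTrunc Λ n).obj W, rightComparison W, ObjectProperty.homMk k,
    ObjectProperty.hom_ext _ hk, ?_⟩
  rintro ⟨⟨s, hs⟩⟩
  obtain ⟨s', hs'⟩ := exists_lift_truncLE n (X := W.obj) s.hom hYs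
  refine ⟨⟨⟨ObjectProperty.homMk s', ObjectProperty.hom_ext _ ?_⟩⟩⟩
  change s' ≫ h.hom = 𝟙 _
  rw [← hk, reassoc_of% hs']
  exact congrArg (fun z => z.hom) hs

lemma factorsThroughImage_incl [IsArtinianRing Λᵐᵒᵖ] {η : ℕ} (hη : 1 ≤ η)
    (hΛ : strongGlobalDimension Λ = η) {Y : CSize Λ (η + 1)} (hY : Indecomposable Y) :
    FactorsThroughImage (leftIncl Λ (η + 1)) Y ∨ FactorsThroughImage (rightIncl Λ (η + 1)) Y := by
  by_cases h : IsZero (Y.obj.X (η + 1))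
  · exact Or.inr (factorsThroughImage_rightIncl (by push_cast; exact h))
  · exact Or.inl (factorsThroughImage_leftIncl hη hΛ hY h)

/-! ### Almost split sequences under the inclusions -/

/-- In a conflation whose first term is Fitting, the first morphism is left almost split if the
second one is right almost split. -/
lemma IsMinimalRightAlmostSplit.exists_extension {n : ℕ} {X B Y : CSize Λ n} {f : X ⟶ B}
    {g : B ⟶ Y} (hfg : IsConflation f g) (hX : IsFitting X) (hg : IsMinimalRightAlmostSplit g)
    (W : CSize Λ n) (u : X ⟶ W) (hu : ¬ IsSplitMono u) : ∃ s : B ⟶ W, f ≫ s = u := by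
  have hι : ∀ {A A' : CSize Λ n} (k : A ⟶ A'), IsSplitEpi k ↔ IsSplitEpi k.hom := fun k =>
    isSplitEpi_map_iff_of_iso (isSize Λ n).ι (Iso.refl _) (Iso.refl _) (by simp)
  have hι' : ∀ {A A' : CSize Λ n} (k : A ⟶ A'), IsSplitMono k ↔ IsSplitMono k.hom := fun k =>
    isSplitMono_map_iff_of_iso (isSize Λ n).ι (Iso.refl _) (Iso.refl _) (by simp)
  obtain ⟨P, q, hP, h⟩ := ((isConflation_iff f g).1 hfg).exists_extension
    ((IsFitting.of_fullyFaithful (isSize Λ n).ι X).2 hX) (fun h => hg.1 ((hι g).2 h)) u.hom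
    fun h => hu ((hι' u).2 h)
  let P' : CSize Λ n := ⟨P, fun j hj => hP j (W.property j hj) (Y.property j hj)⟩
  let q' : P' ⟶ Y := ObjectProperty.homMk q
  obtain ⟨e, he⟩ := h (by
    by_cases hq : IsSplitEpi q'
    · exact Or.inl ((hι q').1 hq)
    · obtain ⟨t, ht⟩ := hg.2.1 P' q' hq
      exact Or.inr ⟨t.hom, congrArg (fun z => z.hom) ht⟩)
  exact ⟨ObjectProperty.homMk e, ObjectProperty.hom_ext _ he⟩

/-- The left minimality of `F.map f` only uses that `F` is fully faithful; that it is left almost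
split is recovered from `F.map g`. -/
lemma IsAlmostSplit.map {n m : ℕ} (F : CSize Λ n ⥤ CSize Λ m) [F.Full] [F.Faithful]
    {X B Y : CSize Λ n} {f : X ⟶ B} {g : B ⟶ Y} (hX : IsFitting X)
    (hF : FactorsThroughImage F Y) (hfg : IsAlmostSplit f g)
    (hconf : IsConflation (F.map f) (F.map g)) : IsAlmostSplit (F.map f) (F.map g) := by
  have hg := hfg.2.2.map F hF
  refine ⟨hconf, ⟨fun h => hfg.2.1.1 ?_, hg.exists_extension hconf
    ((IsFitting.of_fullyFaithful F X).2 hX), fun u hu => ?_⟩, hg⟩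
  · exact (isSplitMono_map_iff_of_iso F (Iso.refl _) (Iso.refl _) (by simp)).2 h
  · have := hfg.2.1.2.2 (F.preimage u) (F.map_injective (by simp [hu]))
    rw [← F.map_preimage u]
    infer_instance

lemma IsAlmostSplit.of_map_iso {n m : ℕ} (F : CSize Λ n ⥤ CSize Λ m) [F.Full] [F.Faithful]
    {X B Y : CSize Λ n} {f : X ⟶ B} {g : B ⟶ Y} {X' B' Y' : CSize Λ m} {f' : X' ⟶ B'}
    {g' : B' ⟶ Y'} (a : F.obj X ≅ X') (b : F.obj B ≅ B') (c : F.obj Y ≅ Y')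
    (hf : F.map f ≫ b.hom = a.hom ≫ f') (hg : F.map g ≫ c.hom = b.hom ≫ g')
    (hconf : IsConflation (F.map f) (F.map g) → IsConflation f g) (h : IsAlmostSplit f' g') :
    IsAlmostSplit f g := by
  refine ⟨hconf ?_, h.2.1.of_map_iso F a b hf, h.2.2.of_map_iso F b c hg⟩
  rw [isConflation_iff]
  exact ((isConflation_iff f' g').1 h.1).of_iso ((isSize Λ m).ι.mapIso a)
    ((isSize Λ m).ι.mapIso b) ((isSize Λ m).ι.mapIso c) (congrArg (fun z => z.hom) hf)
    (congrArg (fun z => z.hom) hg)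

lemma isConflation_leftIncl_iff {n : ℕ} {X B Y : CSize Λ n} (f : X ⟶ B) (g : B ⟶ Y) :
    IsConflation ((leftIncl Λ n).map f) ((leftIncl Λ n).map g) ↔ IsConflation f g := by
  rw [isConflation_iff, isConflation_iff]
  constructor
  · intro h j
    obtain ⟨i, rfl⟩ : ∃ i, j = i + -1 := ⟨j + 1, by omega⟩
    exact h i
  · exact fun h j => h (j + -1)

lemma isConflation_rightIncl_iff {n : ℕ} {X B Y : CSize Λ n} (f : X ⟶ B) (g : B ⟶ Y) :
    IsConflation ((rightIncl Λ n).map f) ((rightIncl Λ n).map g) ↔ IsConflation f g := by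
  rw [isConflation_iff, isConflation_iff]
  exact Iff.rfl

/-! ### Vanishing at one end -/

/-- The ends of an irreducible morphism between indecomposable objects vanish at a common end. If
only `X` vanished at the left end and only `Y` at the right end, `f` would factor through the
truncation of `Y` in the degrees at least `2`; in the opposite case it would factor through a
complex which vanishes at both ends. Neither factor could be split. -/
lemma isZero_or_isZero_of_isIrreducible [IsArtinianRing Λᵐᵒᵖ] {η : ℕ} (hη : 1 ≤ η)
    (hΛ : strongGlobalDimension Λ = η) {X Y : CSize Λ (η + 2)} {f : X ⟶ Y}
    (hX : Indecomposable X) (hY : Indecomposable Y) (hf : IsIrreducible f) :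
    (IsZero (X.obj.X 1) ∧ IsZero (Y.obj.X 1)) ∨
      (IsZero (X.obj.X (η + 2)) ∧ IsZero (Y.obj.X (η + 2))) := by
  have hXs : IsSupp X.obj 1 (η + 2) := fun j hj => X.property j (by push_cast; exact hj)
  have hYs : IsSupp Y.obj 1 (η + 2) := fun j hj => Y.property j (by push_cast; exact hj)
  have hX' := isZero_or_isZero_of_indecomposable hη hΛ hXs (indecomposable_obj hX) (by omega)
  have hY' := isZero_or_isZero_of_indecomposable hη hΛ hYs (indecomposable_obj hY) (by omega)
  by_cases hX1 : IsZero (X.obj.X 1)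
  · by_cases hY1 : IsZero (Y.obj.X 1)
    · exact Or.inl ⟨hX1, hY1⟩
    have hYm := hY'.resolve_left hY1
    by_cases hXm : IsZero (X.obj.X (η + 2))
    · exact Or.inr ⟨hXm, hYm⟩
    exfalso
    obtain ⟨f', hf'⟩ := exists_lift_truncGE 2 f.hom fun j hj => hXs.erase_left hX1 j fun h' => by
      have := h'.1; omega
    let e := ComplexShape.embeddingUpIntGE 2
    have hT : ∀ j, IsZero (Y.obj.X j) → IsZero ((Y.obj.stupidTrunc e).X j) := fun j hj => by
      by_cases h : j < 2
      · exact truncGE_isZero 2 _ h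
      · have := isIso_truncGEι_f 2 Y.obj (not_lt.1 h)
        exact hj.of_iso (asIso ((truncGEι 2 Y.obj).f j))
    let T : CSize Λ (η + 2) := ⟨Y.obj.stupidTrunc e, fun j hj => hT j (Y.property j hj)⟩
    rcases hf.2.2 T (ObjectProperty.homMk f') (ObjectProperty.homMk (truncGEι 2 Y.obj))
      (ObjectProperty.hom_ext _ hf') with ⟨⟨r, hr⟩⟩ | ⟨⟨s, hs⟩⟩
    · exact hXm (isZero_X_of_retract f' r.hom (congrArg (fun z => z.hom) hr) (hT _ hYm))
    · exact hY1 (isZero_X_of_retract s.hom (truncGEι 2 Y.obj) (congrArg (fun z => z.hom) hs)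
        (truncGE_isZero 2 Y.obj (by omega)))
  · have hXm := hX'.resolve_left hX1
    by_cases hYm : IsZero (Y.obj.X (η + 2))
    · exact Or.inr ⟨hXm, hYm⟩
    have hY1 := hY'.resolve_right hYm
    exfalso
    obtain ⟨W, x, y, hW, hxy⟩ := exists_factorization hη hΛ f.hom (a := 1) (b := η + 1)
      ((hXs.erase_right hXm).mono (by omega) (by omega))
      ((hYs.erase_left hY1).mono (by omega) (by omega)) (by omega)
    let W' : CSize Λ (η + 2) := ⟨W, hW.mono (by omega) (by push_cast; omega)⟩
    rcases hf.2.2 W' (ObjectProperty.homMk x) (ObjectProperty.homMk y)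
      (ObjectProperty.hom_ext _ hxy) with ⟨⟨r, hr⟩⟩ | ⟨⟨s, hs⟩⟩
    · exact hX1 (isZero_X_of_retract x r.hom (congrArg (fun z => z.hom) hr)
        (hW 1 fun h' => by have := h'.1; omega))
    · exact hYm (isZero_X_of_retract s.hom y (congrArg (fun z => z.hom) hs)
        (hW _ fun h' => by have := h'.2; omega))

/-- The terms of an almost split sequence vanish at a common end. Otherwise one of the components of
`f` on the summands `B₁` and `B₂` of `B` would factor through `f` by way of a complex which vanishes
at the other end too. Replacing the identity of this summand accordingly gives an endomorphism `β`
of `B` with `f ≫ β = f`, which is invertible because `f` is left minimal; but it is zero at an end,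
so `B` and then `Y` vanish at this end, a contradiction. -/
lemma isZero_or_isZero_of_isAlmostSplit [IsArtinianRing Λᵐᵒᵖ] {η : ℕ} (hη : 1 ≤ η)
    (hΛ : strongGlobalDimension Λ = η) {X B Y : CSize Λ (η + 2)} {f : X ⟶ B} {g : B ⟶ Y}
    (hX : Indecomposable X) (hY : Indecomposable Y) (hfg : IsAlmostSplit f g) :
    (IsZero (X.obj.X 1) ∧ IsZero (B.obj.X 1) ∧ IsZero (Y.obj.X 1)) ∨
      (IsZero (X.obj.X (η + 2)) ∧ IsZero (B.obj.X (η + 2)) ∧ IsZero (Y.obj.X (η + 2))) := by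
  have hXs : IsSupp X.obj 1 (η + 2) := fun j hj => X.property j (by push_cast; exact hj)
  have hYs : IsSupp Y.obj 1 (η + 2) := fun j hj => Y.property j (by push_cast; exact hj)
  have hBs : IsSupp B.obj 1 (η + 2) := fun j hj => B.property j (by push_cast; exact hj)
  have hX' := isZero_or_isZero_of_indecomposable hη hΛ hXs (indecomposable_obj hX) (by omega)
  have hY' := isZero_or_isZero_of_indecomposable hη hΛ hYs (indecomposable_obj hY) (by omega)
  have hd := (isConflation_iff f g).1 hfg.1
  obtain ⟨B₁, B₂, i₁, p₁, i₂, p₂, hB₁, hB₂, e1, e2, e3⟩ := exists_splitting hη hΛ hBs (by omega)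
  have key : ∀ (β : B ⟶ B) (j : ℤ), f ≫ β = f → β.hom.f j = 0 → IsZero (B.obj.X j) := by
    intro β j h1 h2
    have : IsIso β := hfg.2.1.2.2 β h1
    have h3 : β.hom.f j ≫ (inv β).hom.f j = 𝟙 _ :=
      congrArg (fun z => HomologicalComplex.Hom.f z j)
        (congrArg (fun z => z.hom) (IsIso.hom_inv_id β))
    rw [IsZero.iff_id_eq_zero, ← h3, h2, zero_comp]
  by_cases hX1 : IsZero (X.obj.X 1)
  · by_cases hY1 : IsZero (Y.obj.X 1)
    · exact Or.inl ⟨hX1, hd.isZero_middle hX1 hY1, hY1⟩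
    have hYm := hY'.resolve_left hY1
    by_cases hXm : IsZero (X.obj.X (η + 2))
    · exact Or.inr ⟨hXm, hd.isZero_middle hXm hYm, hYm⟩
    exfalso
    -- the component on `B₁` is replaced, by way of the truncation of `B₁` in degrees at least `2`
    obtain ⟨f', hf'⟩ := exists_lift_truncGE 2 (f.hom ≫ p₁) fun j hj =>
      hXs.erase_left hX1 j fun h' => by have := h'.1; omega
    let e := ComplexShape.embeddingUpIntGE 2
    have hT : ∀ j, IsZero (B₁.X j) → IsZero ((B₁.stupidTrunc e).X j) := fun j hj => by
      by_cases h : j < 2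
      · exact truncGE_isZero 2 _ h
      · have := isIso_truncGEι_f 2 B₁ (not_lt.1 h)
        exact hj.of_iso (asIso ((truncGEι 2 B₁).f j))
    let T : CSize Λ (η + 2) := ⟨B₁.stupidTrunc e, fun j hj => hT j (hB₁ j fun h' => hj
      ⟨h'.1, by have := h'.2; push_cast; omega⟩)⟩
    obtain ⟨t, ht⟩ := hfg.2.1.2.1 T (ObjectProperty.homMk f') fun ⟨⟨r, hr⟩⟩ =>
      hXm (isZero_X_of_retract f' r.hom (congrArg (fun z => z.hom) hr)
        (hT _ (hB₁ _ fun h' => by have := h'.2; omega)))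
    have ht' : f.hom ≫ t.hom = f' := congrArg (fun z => z.hom) ht
    refine hY1 (hd.isZero_right (key
      (ObjectProperty.homMk (t.hom ≫ truncGEι 2 B₁ ≫ i₁ + p₂ ≫ i₂)) 1
      (ObjectProperty.hom_ext _ ?_) ?_))
    · change f.hom ≫ (t.hom ≫ truncGEι 2 B₁ ≫ i₁ + p₂ ≫ i₂) = f.hom
      rw [Preadditive.comp_add, reassoc_of% ht', reassoc_of% hf', ← Preadditive.comp_add, e3,
        Category.comp_id]
    · change t.hom.f 1 ≫ (truncGEι 2 B₁).f 1 ≫ i₁.f 1 + p₂.f 1 ≫ i₂.f 1 = 0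
      rw [(truncGE_isZero 2 B₁ (show (1 : ℤ) < 2 by omega)).eq_of_src ((truncGEι 2 B₁).f 1) 0,
        (hB₂ 1 fun h' => by have := h'.1; omega).eq_of_src (i₂.f 1) 0, zero_comp, comp_zero,
        comp_zero, add_zero]
  · have hXm := hX'.resolve_left hX1
    by_cases hYm : IsZero (Y.obj.X (η + 2))
    · exact Or.inr ⟨hXm, hd.isZero_middle hXm hYm, hYm⟩
    exfalso
    -- the component on `B₂` is replaced, by way of a complex which vanishes at both ends
    obtain ⟨W, x, y, hW, hxy⟩ := exists_factorization hη hΛ (f.hom ≫ p₂) (a := 1) (b := η + 1)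
      ((hXs.erase_right hXm).mono (by omega) (by omega))
      (hB₂.mono (by omega) (by omega)) (by omega)
    let W' : CSize Λ (η + 2) := ⟨W, hW.mono (by omega) (by push_cast; omega)⟩
    obtain ⟨t, ht⟩ := hfg.2.1.2.1 W' (ObjectProperty.homMk x) fun ⟨⟨r, hr⟩⟩ =>
      hX1 (isZero_X_of_retract x r.hom (congrArg (fun z => z.hom) hr)
        (hW 1 fun h' => by have := h'.1; omega))
    have ht' : f.hom ≫ t.hom = x := congrArg (fun z => z.hom) ht
    refine hYm (hd.isZero_right (key
      (ObjectProperty.homMk (p₁ ≫ i₁ + t.hom ≫ y ≫ i₂)) (η + 2)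
      (ObjectProperty.hom_ext _ ?_) ?_))
    · change f.hom ≫ (p₁ ≫ i₁ + t.hom ≫ y ≫ i₂) = f.hom
      rw [Preadditive.comp_add, reassoc_of% ht', reassoc_of% hxy, ← Preadditive.comp_add, e3,
        Category.comp_id]
    · change p₁.f _ ≫ i₁.f _ + t.hom.f (η + 2) ≫ y.f _ ≫ i₂.f _ = 0
      rw [(hW (η + 2) fun h' => by have := h'.2; omega).eq_of_src (y.f (η + 2)) 0,
        (hB₁ (η + 2) fun h' => by have := h'.2; omega).eq_of_src (i₁.f (η + 2)) 0, zero_comp,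
        comp_zero, comp_zero, add_zero]

lemma isArtinianRing_mulOpposite (K : Type v) [Field K] [Algebra K Λ] [Module.Finite K Λ] :
    IsArtinianRing Λᵐᵒᵖ :=
  have : Module.Finite K Λᵐᵒᵖ := Module.Finite.equiv (MulOpposite.opLinearEquiv K)
  IsArtinianRing.of_finite K Λᵐᵒᵖ

end Algebra

end FixedSizeComplexes

theorem theorem2p16
    (K : Type v) [Field K] [IsAlgClosed K]
    (Λ : Type u) [Ring Λ] [Algebra K Λ] [Module.Finite K Λ]
    (η : ℕ) (hη : 1 ≤ η) (hΛ : strongGlobalDimension Λ = η) :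
    -- irreducible morphisms: inclusion
    (∀ (X Y : CSize Λ (η + 1)) (f : X ⟶ Y), Indecomposable X → Indecomposable Y →
      (IsIrreducible f ↔
        IsIrreducible ((leftIncl Λ (η + 1)).map f) ∨
          IsIrreducible ((rightIncl Λ (η + 1)).map f))) ∧
    -- irreducible morphisms: truncation
    (∀ (X Y : CSize Λ (η + 2)) (f : X ⟶ Y), Indecomposable X → Indecomposable Y →
      IsIrreducible f →
        (IsZero (X.obj.X 1) ∧ IsZero (Y.obj.X 1) ∧
            IsIrreducible ((leftTrunc Λ (η + 1)).map f)) ∨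
          (IsZero (X.obj.X (η + 2)) ∧ IsZero (Y.obj.X (η + 2)) ∧
            IsIrreducible ((rightTrunc Λ (η + 1)).map f))) ∧
    -- almost split sequences: inclusion
    (∀ (X B Y : CSize Λ (η + 1)) (f : X ⟶ B) (g : B ⟶ Y),
      Indecomposable X → Indecomposable Y →
      (IsAlmostSplit f g ↔
        IsAlmostSplit ((leftIncl Λ (η + 1)).map f) ((leftIncl Λ (η + 1)).map g) ∨
          IsAlmostSplit ((rightIncl Λ (η + 1)).map f) ((rightIncl Λ (η + 1)).map g))) ∧
    -- almost split sequences: truncation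
    (∀ (X B Y : CSize Λ (η + 2)) (f : X ⟶ B) (g : B ⟶ Y),
      Indecomposable X → Indecomposable Y → IsAlmostSplit f g →
        (IsZero (X.obj.X 1) ∧ IsZero (B.obj.X 1) ∧ IsZero (Y.obj.X 1) ∧
            IsAlmostSplit ((leftTrunc Λ (η + 1)).map f) ((leftTrunc Λ (η + 1)).map g)) ∨
          (IsZero (X.obj.X (η + 2)) ∧ IsZero (B.obj.X (η + 2)) ∧ IsZero (Y.obj.X (η + 2)) ∧
            IsAlmostSplit ((rightTrunc Λ (η + 1)).map f)
              ((rightTrunc Λ (η + 1)).map g))) := by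
  have hart : IsArtinianRing Λᵐᵒᵖ := isArtinianRing_mulOpposite K
  have hi : (η : ℤ) + 2 = ((η + 1 : ℕ) : ℤ) + 1 := by push_cast; ring
  have hsymm {X Y : CSize Λ (η + 2)} (f : X ⟶ Y) [IsIso (rightComparison X)]
      [IsIso (rightComparison Y)] :
      (rightIncl Λ (η + 1)).map ((rightTrunc Λ (η + 1)).map f) ≫
        (asIso (rightComparison Y)).symm.hom = (asIso (rightComparison X)).symm.hom ≫ f := by
    rw [Iso.symm_hom, Iso.symm_hom, Iso.comp_inv_eq, Category.assoc, Iso.eq_inv_comp]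
    exact rightComparison_naturality f
  refine ⟨fun X Y f _ hY => ⟨fun hf => ?_, ?_⟩, fun X Y f hX hY hf => ?_,
    fun X B Y f g hX hY => ⟨fun hfg => ?_, ?_⟩, fun X B Y f g hX hY hfg => ?_⟩
  · exact (factorsThroughImage_incl hη hΛ hY).imp (fun h => hf.map _ h) (fun h => hf.map _ h)
  · rintro (h | h)
    · exact h.of_map_iso _ (Iso.refl _) (Iso.refl _) (by simp)
    · exact h.of_map_iso _ (Iso.refl _) (Iso.refl _) (by simp)
  · refine (isZero_or_isZero_of_isIrreducible hη hΛ hX hY hf).imp ?_ ?_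
    · rintro ⟨h1, h2⟩
      have := isIso_leftComparison h1
      have := isIso_leftComparison h2
      exact ⟨h1, h2, hf.of_map_iso _ (asIso (leftComparison X)) (asIso (leftComparison Y))
        (leftComparison_naturality f)⟩
    · rintro ⟨h1, h2⟩
      have := isIso_rightComparison hi h1
      have := isIso_rightComparison hi h2
      exact ⟨h1, h2, hf.of_map_iso _ (asIso (rightComparison X)).symm
        (asIso (rightComparison Y)).symm (hsymm f)⟩
  · have hX' := isFitting_of_indecomposable_cSize hX
    exact (factorsThroughImage_incl hη hΛ hY).imp
      (fun h => hfg.map _ hX' h ((isConflation_leftIncl_iff f g).2 hfg.1))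
      (fun h => hfg.map _ hX' h ((isConflation_rightIncl_iff f g).2 hfg.1))
  · rintro (h | h)
    · exact h.of_map_iso _ (Iso.refl _) (Iso.refl _) (Iso.refl _) (by simp) (by simp)
        (isConflation_leftIncl_iff f g).1
    · exact h.of_map_iso _ (Iso.refl _) (Iso.refl _) (Iso.refl _) (by simp) (by simp)
        (isConflation_rightIncl_iff f g).1
  · refine (isZero_or_isZero_of_isAlmostSplit hη hΛ hX hY hfg).imp ?_ ?_
    · rintro ⟨h1, h2, h3⟩
      have := isIso_leftComparison h1
      have := isIso_leftComparison h2
      have := isIso_leftComparison h3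
      exact ⟨h1, h2, h3, hfg.of_map_iso _ (asIso (leftComparison X)) (asIso (leftComparison B))
        (asIso (leftComparison Y)) (leftComparison_naturality f) (leftComparison_naturality g)
        (isConflation_leftIncl_iff _ _).1⟩
    · rintro ⟨h1, h2, h3⟩
      have := isIso_rightComparison hi h1
      have := isIso_rightComparison hi h2
      have := isIso_rightComparison hi h3
      exact ⟨h1, h2, h3, hfg.of_map_iso _ (asIso (rightComparison X)).symm
        (asIso (rightComparison B)).symm (asIso (rightComparison Y)).symm
        (hsymm f) (hsymm g)
        (isConflation_rightIncl_iff _ _).1⟩
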